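/- **Setting.** Let $\mathcal U=\{1,2,\dots\}$ be the universe of players. For a finite $N\subseteq\mathcal U$, a game on $N$ is a map $v:2^N\to\mathbb R$ with $v(\emptyset)=0$, and a graph on $N$ is a simple undirected graph $\Gamma=(N,E)$. For $S\subseteq N$, $\mathcal K_\Gamma(S)$ is the set of connected components (node sets) of the induced subgraph $\Gamma_S$, and $\mathcal K_\Gamma=\mathcal K_\Gamma(N)$. The graph-restricted game is $v^\Gamma(S)=\sum_{C\in\mathcal K_\Gamma(S)}v(C)$. The Shapley interaction index of a non-empty $S\subseteq N$ is $$SI^v(S)=\sum_{T\subseteq N\setminus S}\frac{(|N|-|T|-|S|)!\,|T|!}{(|N|-|S|+1)!}\sum_{L\subseteq S}(-1)^{|S|-|L|}v(T\cup L),$$ and the Myerson interaction index is $MI^{v,\Gamma}(S)=SI^{v^\Gamma}(S)$. A minimal $S$-connecting set is an inclusion-minimal $R\subseteq N$ with $S\subseteq R$ such that any two nodes of $S$ are connected in $\Gamma_R$. The set $B_\Gamma(S)$ of intermediaries of $S$ consists of the nodes outside $S$ that lie in some minimal $S$-connecting set; the set $EB_\Gamma(S)$ of essential intermediaries consists of those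 that lie in all of them (so $EB_\Gamma(S)=\emptyset$ if $S$ cannot be connected in $\Gamma$). A player $i$ is null in $v$ if $v(S\cup i)=v(S)$ for all $S\subseteq N\setminus i$. A player $i$ is graph null in $(N,v,\Gamma)$ if $i$ is null in $v$ and, for all $j\ne k$ in $N\setminus i$ with $i\in B_\Gamma(\{j,k\})$, at least one of $j,k$ is null in $v$. A non-empty $P\subseteq N$ is a veto partnership of $v$ if $v(T\cup S)=v(T)=0$ for all $T\subseteq N\setminus P$ and all $S\subsetneq P$. A veto graph partnership of $(N,v,\Gamma)$ is a non-empty $Q\subseteq P\cup EB_\Gamma(P)$ for some veto partnership $P$ of $v$. For non-empty $P\subseteq N$, fix a proxy $[P]\in\mathcal U\setminus(N\setminus P)$. The choice, which may depend on $N$ and $P$, is arbitrary, and the theorem holds for every such choice. For a game $w$ and a graph $\Gamma$ on $N$, the quotients are defined on the player set $(N\setminus P)\cup\{[P]\}$ as follows: $w_{[P]}(S)=w(S)$ and $w_{[P]}(S\cup[P])=w(S\cup P)$ for $S\subseteq N\setminus P$; in $\Gamma_{[P]}$ two nodes of $N\setminus P$ are adjacent iff they are adjacent in $\Gamma$, and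 $[P]$ is adjacent to $j\in N\setminus P$ iff $j$ is adjacent in $\Gamma$ to some member of $P$. A *graph interaction index* $I$ assigns a real number $I^{v,\Gamma}(S)$ to every finite $N\subseteq\mathcal U$, every game $v$ and graph $\Gamma$ on $N$, and every non-empty $S\subseteq N$, such that $I^{v,\Gamma}(S)=0$ if $S$ is contained in no component of $\Gamma$, and $I^{v,\Gamma}(S)=I^{v|_C,\Gamma_C}(S)$ if $S\subseteq C\in\mathcal K_\Gamma$. **Theorem.** The Myerson interaction index $MI$ is a graph interaction index satisfying the following five properties, required for all finite $N\subseteq\mathcal U$ and all games and graphs on $N$, and it is the only graph interaction index satisfying them. - *$I$-Component Efficiency:* $\sum_{i\in C}I^{v,\Gamma}(\{i\})=v(C)$ for all $C\in\mathcal K_\Gamma$. - *$I$-Fairness:* for every edge $\{i,j\}$ of $\Gamma$ and all $S\subseteq N\setminus\{i,j\}$, with $\Gamma_{-ij}$ the graph obtained by removing that edge, $I^{v,\Gamma}(S\cup i)-I^{v,\Gamma_{-ij}}(S\cup i)=I^{v,\Gamma}(S\cup j)-I^{v,\Gamma_{-ij}}(S\cup j)$. - *$I$-Graph Null:* $I^{v,\Gamma}(S\cup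 i)=0$ for every graph null player $i$ and all $S\subseteq N\setminus i$. - *$I$-Linearity:* $I^{\alpha_1v_1+\alpha_2v_2,\Gamma}(S)=\alpha_1I^{v_1,\Gamma}(S)+\alpha_2I^{v_2,\Gamma}(S)$ for all $\alpha_1,\alpha_2\in\mathbb R$, games $v_1,v_2$ on $N$ and non-empty $S\subseteq N$. - *$I$-Strong Reduced Veto Partnership Consistency:* $I^{v,\Gamma}(P\cup S)=I^{(v^\Gamma)_{[P]},\Gamma_{[P]}}([P]\cup S)$ for every veto graph partnership $P$ and all $S\subseteq N\setminus P$. -/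

import Mathlib

open Finset
open scoped Nat

namespace Myerson

/-! ### Coalitional games -/

section Games

variable {V : Type*}

/-- The space `G^V` of coalitional (TU) games with player set `V`: all maps `v : 2^V → ℝ` with
`v ∅ = 0`, as a real vector space. -/
def Game (V : Type*) : Submodule ℝ (Finset V → ℝ) where
  carrier := {v | v ∅ = 0}
  add_mem' := by
    intro a b ha hb
    simp only [Set.mem_ofPred_eq] at ha hb ⊢
    simp [ha, hb]
  zero_mem' := by simp
  smul_mem' := by
    intro c a ha
    simp only [Set.mem_ofPred_eq] at ha ⊢
    simp [ha]

/-- The non-empty coalitions, on which an interaction index is defined. -/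
abbrev Coalition (V : Type*) : Type _ := {S : Finset V // S.Nonempty}

/-- Player `i` is a null player of `v`: `v (S ∪ i) = v S` for all `S ⊆ V \ i`. -/
def IsNullPlayer [DecidableEq V] (v : Game V) (i : V) : Prop :=
  ∀ S : Finset V, i ∉ S → v.1 (insert i S) = v.1 S

/-- The non-empty coalition `P` is a veto partnership of `v`: `v (T ∪ S) = v T = 0` for all
`T ⊆ V \ P` and all proper subsets `S` of `P`. -/
def IsVetoPartnership [DecidableEq V] (v : Game V) (P : Finset V) : Prop :=
  P.Nonempty ∧
    ∀ T S : Finset V, Disjoint T P → S ⊂ P → v.1 (T ∪ S) = v.1 T ∧ v.1 T = 0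

/-- The `S`-derivative `δ_S^v(T) = ∑_{L ⊆ S} (-1)^{s-l} v(T ∪ L)`. -/
def derivative [DecidableEq V] (v : Game V) (S T : Finset V) : ℝ :=
  ∑ L ∈ S.powerset, (-1 : ℝ) ^ (S.card - L.card) * v.1 (T ∪ L)

/-- The Shapley interaction index
`SI^v(S) = ∑_{T ⊆ V \ S} (n-t-s)! t! / (n-s+1)! δ_S^v(T)`. -/
noncomputable def shapleyIndex [Fintype V] [DecidableEq V] (v : Game V) (S : Coalition V) : ℝ :=
  ∑ T ∈ (S.1ᶜ).powerset,
    (((Fintype.card V - T.card - S.1.card)! : ℝ) * ((T.card)! : ℝ)) /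
      ((Fintype.card V - S.1.card + 1)! : ℝ) * derivative v S.1 T

/-- The restriction of a game along an inclusion `ι` of player sets. -/
def restrictTo {W : Type*} (v : Game V) (ι : W ↪ V) : Game W :=
  ⟨fun S => v.1 (S.map ι), by
    have h : v.1 ∅ = 0 := v.2
    change v.1 ((∅ : Finset W).map ι) = 0
    rw [Finset.map_empty, h]⟩

end Games

/-! ### Graphs -/

section Graphs

variable {V : Type*}

/-- `i` and `j` both lie in `S` and are connected in the subgraph `Γ_S` induced by `S`. -/
def ConnIn (Γ : SimpleGraph V) (S : Finset V) (i j : V) : Prop :=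
  ∃ (hi : i ∈ S) (hj : j ∈ S),
    (Γ.induce (S : Set V)).Reachable ⟨i, Finset.mem_coe.2 hi⟩ ⟨j, Finset.mem_coe.2 hj⟩

open Classical in
/-- The connected component of the node `i` in the induced subgraph `Γ_S`, as a set of nodes. -/
noncomputable def componentOf (Γ : SimpleGraph V) (S : Finset V) (i : V) : Finset V :=
  S.filter fun j => ConnIn Γ S i j

/-- `K_Γ(S)`: the collection of (node sets of) connected components of `Γ_S`. -/
noncomputable def components [DecidableEq V] (Γ : SimpleGraph V) (S : Finset V) :
    Finset (Finset V) :=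
  S.image (componentOf Γ S)

/-- The subgraph induced by `R` connects `S`: it contains `S` and any two nodes of `S` are
connected in `Γ_R`. -/
def Connects (Γ : SimpleGraph V) (R S : Finset V) : Prop :=
  S ⊆ R ∧ ∀ i ∈ S, ∀ j ∈ S, ConnIn Γ R i j

open Classical in
/-- `M_Γ(S)`: the node sets of the minimal `S`-connecting subgraphs. -/
noncomputable def minimalConnecting [Fintype V] (Γ : SimpleGraph V) (S : Finset V) :
    Finset (Finset V) :=
  univ.filter fun R => Connects Γ R S ∧ ∀ R' : Finset V, R' ⊂ R → ¬ Connects Γ R' S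

/-- `B_Γ(S)`: the intermediaries of `S`, i.e. the nodes outside `S` that belong to some minimal
`S`-connecting subgraph. -/
noncomputable def intermediaries [Fintype V] [DecidableEq V] (Γ : SimpleGraph V)
    (S : Finset V) : Finset V :=
  (minimalConnecting Γ S).biUnion id \ S

open Classical in
/-- `EB_Γ(S)`: the essential intermediaries of `S`, i.e. the intermediaries that belong to every
minimal `S`-connecting subgraph. (There are none if `S` cannot be connected in `Γ`.) -/
noncomputable def essentialIntermediaries [Fintype V] [DecidableEq V] (Γ : SimpleGraph V)
    (S : Finset V) : Finset V :=
  (intermediaries Γ S).filter fun i => ∀ R ∈ minimalConnecting Γ S, i ∈ R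

end Graphs

/-! ### Games with communication graphs -/

section Communication

variable {V : Type*} [DecidableEq V]

/-- The graph-restricted game `v^Γ(S) = ∑_{C ∈ K_Γ(S)} v(C)`. -/
noncomputable def restrictedGame (v : Game V) (Γ : SimpleGraph V) : Game V :=
  ⟨fun S => ∑ C ∈ components Γ S, v.1 C, by
    change ∑ C ∈ components Γ ∅, v.1 C = 0
    simp [components]⟩

/-- Player `i` is a graph null player of `(V, v, Γ)`: a null player of `v` such that, whenever
`i` is an intermediary of a pair of other players, one of the two is a null player of `v`. -/
def IsGraphNull [Fintype V] (v : Game V) (Γ : SimpleGraph V) (i : V) : Prop :=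
  IsNullPlayer v i ∧
    ∀ j k : V, j ≠ i → k ≠ i → j ≠ k → i ∈ intermediaries Γ {j, k} →
      IsNullPlayer v j ∨ IsNullPlayer v k

/-- `Q` is a veto graph partnership of `(V, v, Γ)`: it is non-empty and contained in
`P ∪ EB_Γ(P)` for some veto partnership `P` of `v`. -/
def IsVetoGraphPartnership [Fintype V] (v : Game V) (Γ : SimpleGraph V) (Q : Finset V) : Prop :=
  Q.Nonempty ∧ ∃ P : Finset V, IsVetoPartnership v P ∧ Q ⊆ P ∪ essentialIntermediaries Γ P

end Communication

/-! ### Quotients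

The universe of players is `ℕ+`, and player sets are its finite subsets `N`. In a quotient the
coalition `P` of `N` is replaced by a single player `p`, its proxy, which is a member of the
universe that does not occur in `N \ P`. -/

section Quotients

variable {N : Finset ℕ+}

/-- The player set `[P] ∪ (N \ P)` of a quotient, where `p` is the proxy `[P]`. -/
def quotientPlayers (P : Finset N) (p : ℕ+) : Finset ℕ+ :=
  insert p ((Pᶜ).map (Function.Embedding.subtype _))

/-- The proxy as a member of the player set of the quotient. -/
def proxy (P : Finset N) (p : ℕ+) : quotientPlayers P p :=
  ⟨p, Finset.mem_insert_self _ _⟩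

/-- The map from `N` to the player set of the quotient that sends the members of `P` to the proxy
and fixes all other players. -/
def proj (P : Finset N) (p : ℕ+) (i : N) : quotientPlayers P p :=
  if h : i ∈ P then proxy P p
  else ⟨i.1, Finset.mem_insert_of_mem
    (Finset.mem_map_of_mem (Function.Embedding.subtype _) (Finset.mem_compl.2 h))⟩

/-- The quotient game: for `S ⊆ N \ P` the coalition `S` keeps its worth `v S`, and the coalition
consisting of `S` and the proxy is worth `v (S ∪ P)`. -/
def quotientGame (v : Game N) (P : Finset N) (p : ℕ+) : Game (quotientPlayers P p) :=
  ⟨fun R => v.1 (univ.filter fun i => proj P p i ∈ R), by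
    have h : v.1 ∅ = 0 := v.2
    change v.1 (univ.filter fun i => proj P p i ∈ (∅ : Finset (quotientPlayers P p))) = 0
    simp [h]⟩

/-- The quotient graph: the proxy is adjacent to another node iff that node is adjacent to some
member of `P`; adjacency between other nodes is unchanged. -/
def quotientGraph (Γ : SimpleGraph N) (P : Finset N) (p : ℕ+) :
    SimpleGraph (quotientPlayers P p) where
  Adj a b := a ≠ b ∧ ∃ i j : N, Γ.Adj i j ∧ proj P p i = a ∧ proj P p j = b
  symm := ⟨by
    rintro a b ⟨hab, i, j, hij, hi, hj⟩
    exact ⟨hab.symm, j, i, hij.symm, hj, hi⟩⟩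
  loopless := ⟨fun _ h => h.1 rfl⟩

/-- A naming rule for proxies: for every player set `N` and non-empty `P ⊆ N`, the name of the
proxy `[P]` is a player of the universe that does not belong to `N \ P`. -/
def IsProxyNaming (ρ : (N : Finset ℕ+) → Finset N → ℕ+) : Prop :=
  ∀ (N : Finset ℕ+) (P : Finset N), P.Nonempty →
    ρ N P ∉ (Pᶜ).map (Function.Embedding.subtype (· ∈ N))

end Quotients

/-! ### Graph interaction indices and axioms -/

/-- An assignment of a real number `I^{v,Γ}(S)` to every finite player set `N`, game `v` and graph
`Γ` on `N` and non-empty coalition `S ⊆ N`. -/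
abbrev Index : Type :=
  (N : Finset ℕ+) → Game N → SimpleGraph N → Coalition N → ℝ

/-- The inclusion of a player set in a larger one. -/
def incl {C N : Finset ℕ+} (h : C ⊆ N) : C ↪ N :=
  ⟨fun i => ⟨i.1, h i.2⟩, fun _ _ hij => Subtype.ext (congrArg (fun x : N => x.1) hij)⟩

/-- `I` is a graph interaction index: coalitions not contained in one connected component have
index zero, and the index of a coalition `S` contained in a component `C` is computed in the
game and the graph restricted to `C`. -/
def IsGraphInteractionIndex (I : Index) : Prop :=
  ∀ (N : Finset ℕ+) (v : Game N) (Γ : SimpleGraph N),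
    (∀ S : Coalition N, (¬ ∃ C ∈ components Γ univ, S.1 ⊆ C) → I N v Γ S = 0) ∧
    (∀ (C : Finset ℕ+) (hC : C ⊆ N), (univ : Finset C).map (incl hC) ∈ components Γ univ →
      ∀ S : Coalition C,
        I N v Γ ⟨S.1.map (incl hC), S.2.map⟩ =
          I C (restrictTo v (incl hC)) (Γ.comap (incl hC)) S)

/-- The Myerson interaction index `MI^{v,Γ}(S) = SI^{v^Γ}(S)`. -/
noncomputable def myersonIndex : Index :=
  fun _ v Γ S => shapleyIndex (restrictedGame v Γ) S

/-- Component efficiency. -/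
def ComponentEfficiency (I : Index) : Prop :=
  ∀ (N : Finset ℕ+) (v : Game N) (Γ : SimpleGraph N), ∀ C ∈ components Γ univ,
    ∑ i ∈ C, I N v Γ ⟨{i}, Finset.singleton_nonempty i⟩ = v.1 C

/-- Fairness. -/
def Fairness (I : Index) : Prop :=
  ∀ (N : Finset ℕ+) (v : Game N) (Γ : SimpleGraph N) (i j : N), Γ.Adj i j →
    ∀ S : Finset N, i ∉ S → j ∉ S →
      I N v Γ ⟨insert i S, Finset.insert_nonempty i S⟩ -
          I N v (Γ.deleteEdges {s(i, j)}) ⟨insert i S, Finset.insert_nonempty i S⟩ =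
        I N v Γ ⟨insert j S, Finset.insert_nonempty j S⟩ -
          I N v (Γ.deleteEdges {s(i, j)}) ⟨insert j S, Finset.insert_nonempty j S⟩

/-- The graph null axiom. -/
def GraphNull (I : Index) : Prop :=
  ∀ (N : Finset ℕ+) (v : Game N) (Γ : SimpleGraph N) (i : N), IsGraphNull v Γ i →
    ∀ S : Finset N, i ∉ S → I N v Γ ⟨insert i S, Finset.insert_nonempty i S⟩ = 0

/-- Linearity. -/
def Linearity (I : Index) : Prop :=
  ∀ (N : Finset ℕ+) (a₁ a₂ : ℝ) (v₁ v₂ : Game N) (Γ : SimpleGraph N) (S : Coalition N),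
    I N (a₁ • v₁ + a₂ • v₂) Γ S = a₁ * I N v₁ Γ S + a₂ * I N v₂ Γ S

/-- Strong reduced veto partnership consistency, for proxies named by `ρ`: for every veto graph
partnership `P` and `S ⊆ N \ P`, the index of `P ∪ S` equals the index of `[P] ∪ S` in the
quotient of the graph-restricted game with the quotient graph. -/
def StrongReducedVetoPartnershipConsistency (ρ : (N : Finset ℕ+) → Finset N → ℕ+)
    (I : Index) : Prop :=
  ∀ (N : Finset ℕ+) (v : Game N) (Γ : SimpleGraph N) (P : Finset N)
    (hP : IsVetoGraphPartnership v Γ P) (S : Finset N), Disjoint S P →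
      I N v Γ ⟨P ∪ S, hP.1.mono Finset.subset_union_left⟩ =
        I (quotientPlayers P (ρ N P)) (quotientGame (restrictedGame v Γ) P (ρ N P))
          (quotientGraph Γ P (ρ N P))
          ⟨insert (proxy P (ρ N P)) (S.image (proj P (ρ N P))), Finset.insert_nonempty _ _⟩

end Myerson

/-! Existence is a statement about Harsanyi dividends. On unanimity games the Shapley interaction
index is computed directly, and by linearity the index of `S` is the sum over `T ⊇ S` of the
dividend of `T` divided by `|T \ S| + 1` (`shapleyIndex_eq_sum_dividend`). Each property of the
Myerson index then says which dividends of the graph-restricted game vanish: those of coalitions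
that cross between components, that contain a graph null player, or that do not contain a given veto
graph partnership. For fairness, the game that vanishes on coalitions not containing both ends of
the edge is the difference of the two restricted games. For consistency, contracting `P` matches the
remaining dividends one to one (`shapleyIndex_quotientGame`), and restricting the quotient game by
the quotient graph changes nothing (`restrictedGame_quotientGame`).

Uniqueness is an induction on `|S|` and, inside it, on the graph. Let `D` be the difference of two
indices on coalitions of size `s`. Fairness and the induction over graphs with an edge removed make
`D` invariant when a member moves along an edge, hence when it moves to any free node of its
component. For `s = 1`, `D` is therefore constant on each component, and component efficiency forces
it to be zero. For `s > 1`, linearity reduces to the unanimity game of some `T`. If `T` leaves the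
component of `S`, the restriction to that component is the zero game. If `T = {t}`, some member of
`S` is graph null. Otherwise `S` is moved until it contains two members of `T`; this pair is a veto
graph partnership, and contracting it gives a smaller coalition. -/

namespace Myerson

/-! ### Dividends and the Shapley interaction index -/

section Dividends

variable {V : Type*} [DecidableEq V]

/-- The Harsanyi dividends of a set function. -/
noncomputable def dividend (f : Finset V → ℝ) (S : Finset V) : ℝ :=
  f S - ∑ T ∈ S.ssubsets.attach, dividend f T.1
termination_by S.card
decreasing_by exact card_lt_card (mem_ssubsets.1 T.2)

theorem sum_dividend (f : Finset V → ℝ) (S : Finset V) :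
    ∑ T ∈ S.powerset, dividend f T = f S := by
  have h : S.powerset = insert S S.ssubsets := by
    ext T
    simp only [mem_powerset, mem_insert, mem_ssubsets]
    exact le_iff_eq_or_lt
  rw [h, sum_insert (by simp), dividend, sum_attach S.ssubsets (fun T => dividend f T)]
  ring

/-- Uniqueness of Möbius inversion. It turns every later claim about dividends into the check that a
proposed function has the right sums over subsets. -/
theorem eq_dividend {f a : Finset V → ℝ} (h : ∀ S, ∑ T ∈ S.powerset, a T = f S) :
    a = dividend f := by
  funext S
  induction S using Finset.strongInduction with
  | H S ih =>
    have hS : S.powerset = insert S S.ssubsets := by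
      ext T
      simp only [mem_powerset, mem_insert, mem_ssubsets]
      exact le_iff_eq_or_lt
    have h1 := h S
    have h2 := sum_dividend f S
    rw [hS, sum_insert (by simp)] at h1 h2
    have h3 : ∑ T ∈ S.ssubsets, a T = ∑ T ∈ S.ssubsets, dividend f T :=
      sum_congr rfl fun T hT => ih T (mem_ssubsets.1 hT)
    linarith

theorem dividend_empty (v : Game V) : dividend v.1 ∅ = 0 := by
  have h := sum_dividend v.1 ∅
  have hv : v.1 ∅ = 0 := v.2
  simpa [hv] using h

/-- The dividends of a function that is determined by the traces `S ∩ A` and `S \ A` are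
supported by the subsets of `A` and of its complement. -/
theorem dividend_eq_zero_of_split (v : Game V) (A : Finset V)
    (h : ∀ S, v.1 S = v.1 (S ∩ A) + v.1 (S \ A)) {T : Finset V} {i j : V} (hi : i ∈ T)
    (hj : j ∈ T) (hiA : i ∈ A) (hjA : j ∉ A) : dividend v.1 T = 0 := by
  classical
  -- Keeping only the dividends inside `A` or off `A` loses nothing: their sum over subsets of `S`
  -- is that over `S ∩ A` plus that over `S \ A`, with overlap `∅` alone, whose dividend is zero.
  have key : (fun T => if T ⊆ A ∨ Disjoint T A then dividend v.1 T else 0) = dividend v.1 := by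
    refine eq_dividend fun S => ?_
    rw [← sum_filter, h S, ← sum_dividend v.1 (S ∩ A), ← sum_dividend v.1 (S \ A),
      ← sum_union_inter, filter_or]
    have h1 : (S.powerset.filter fun T => T ⊆ A) = (S ∩ A).powerset := by
      ext T; simp only [mem_filter, mem_powerset, subset_inter_iff]
    have h2 : (S.powerset.filter fun T => Disjoint T A) = (S \ A).powerset := by
      ext T; simp [subset_sdiff]
    have h3 : (S ∩ A).powerset ∩ (S \ A).powerset = {∅} := by
      ext T
      simp only [mem_inter, mem_powerset, mem_singleton]
      constructor
      · rintro ⟨a, b⟩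
        refine eq_empty_of_forall_notMem fun x hx => ?_
        exact (mem_sdiff.1 (b hx)).2 (mem_inter.1 (a hx)).2
      · rintro rfl; simp
    rw [h1, h2, h3]
    simp [dividend_empty]
  rw [← key]
  have : ¬ (T ⊆ A ∨ Disjoint T A) := by
    rintro (h | h)
    · exact hjA (h hj)
    · exact disjoint_left.1 h hi hiA
  simp [this]

/-- If `f` vanishes on all sets that do not contain `P`, so do its dividends. -/
theorem dividend_eq_zero_of_not_subset {f : Finset V → ℝ} {P : Finset V}
    (h : ∀ S, ¬ P ⊆ S → f S = 0) {T : Finset V} (hT : ¬ P ⊆ T) : dividend f T = 0 := by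
  have key : (fun T => if P ⊆ T then dividend f T else 0) = dividend f := by
    refine eq_dividend fun S => ?_
    by_cases hS : P ⊆ S
    · rw [← sum_dividend f S]
      refine sum_congr rfl fun T hT => ?_
      split_ifs with hPT
      · rfl
      · clear hS hT
        induction T using Finset.strongInduction with
        | H T ih =>
          have h1 := sum_dividend f T
          rw [h T hPT, sum_eq_single T] at h1
          · exact h1.symm
          · intro U hU hne
            have hU' := mem_powerset.1 hU
            exact (ih U (lt_of_le_of_ne hU' hne) fun hP => hPT (hP.trans hU')).symm
          · simp
    · rw [h S hS]
      exact sum_eq_zero fun T hT => if_neg fun hP => hS (hP.trans (mem_powerset.1 hT))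
  rw [← key]
  simp [hT]

theorem dividend_eq_zero_of_null (v : Game V) {i : V} (h : IsNullPlayer v i) {T : Finset V}
    (hT : i ∈ T) : dividend v.1 T = 0 := by
  have key : (fun T => if i ∈ T then 0 else dividend v.1 T) = dividend v.1 := by
    refine eq_dividend fun S => ?_
    have h1 : v.1 S = v.1 (S.erase i) := by
      by_cases hi : i ∈ S
      · rw [← h _ (notMem_erase i S), insert_erase hi]
      · rw [erase_eq_of_notMem hi]
    rw [h1, ← sum_dividend v.1 (S.erase i)]
    simp_rw [← ite_not (i ∈ _)]
    rw [← sum_filter]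
    refine sum_congr ?_ fun _ _ => rfl
    ext T
    simp [subset_erase]
  rw [← key]
  simp [hT]

/-- The unanimity game of the coalition `T` (the zero game if `T` is empty). -/
def unanimity (T : Finset V) : Game V :=
  ⟨fun S => if T.Nonempty ∧ T ⊆ S then 1 else 0, by
    change (if T.Nonempty ∧ T ⊆ ∅ then (1 : ℝ) else 0) = 0
    refine if_neg ?_
    rintro ⟨h, h'⟩
    exact h.ne_empty (subset_empty.1 h')⟩

theorem unanimity_apply (T S : Finset V) :
    (unanimity T).1 S = if T.Nonempty ∧ T ⊆ S then 1 else 0 := rfl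

theorem game_eq_sum_unanimity [Fintype V] (v : Game V) :
    v = ∑ T : Finset V, dividend v.1 T • unanimity T := by
  refine Subtype.ext (funext fun S => ?_)
  rw [Submodule.coe_sum, Finset.sum_apply, ← sum_dividend v.1 S, ← sum_filter_add_sum_filter_not univ
    (fun T => T ⊆ S)]
  have h1 : (univ.filter fun T => T ⊆ S) = S.powerset := by ext; simp
  rw [h1]
  have h2 : ∑ T ∈ univ.filter (fun T => ¬ T ⊆ S),
      ((dividend v.1 T • unanimity T : Game V) : Finset V → ℝ) S = 0 := by
    refine sum_eq_zero fun T hT => ?_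
    have : ¬ T ⊆ S := (mem_filter.1 hT).2
    change dividend v.1 T * (unanimity T).1 S = 0
    simp [unanimity_apply, this]
  rw [h2, add_zero]
  refine sum_congr rfl fun T hT => ?_
  change _ = dividend v.1 T * (unanimity T).1 S
  rcases T.eq_empty_or_nonempty with rfl | hne
  · simp [dividend_empty]
  · simp [unanimity_apply, hne, mem_powerset.1 hT]

/-- The condition `A ⊆ T ∪ L` separates into `A \ S ⊆ T` and `A ∩ S ⊆ L`. The alternating sum over
the `L` between `A ∩ S` and `S` cancels unless `A ∩ S = S`. -/
theorem derivative_unanimity {S T A : Finset V} (hA : A.Nonempty) (hT : Disjoint T S) :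
    derivative (unanimity A) S T = if S ⊆ A ∧ A \ S ⊆ T then 1 else 0 := by
  have h0 : ∀ L ∈ S.powerset, (-1 : ℝ) ^ (S.card - L.card) * (unanimity A).1 (T ∪ L) =
      if A \ S ⊆ T ∧ A ∩ S ⊆ L then (-1 : ℝ) ^ (S.card - L.card) else 0 := by
    intro L hL
    have hL := mem_powerset.1 hL
    have : A ⊆ T ∪ L ↔ A \ S ⊆ T ∧ A ∩ S ⊆ L := by
      constructor
      · intro h
        constructor
        · intro x hx
          have := h (mem_sdiff.1 hx).1
          rcases mem_union.1 this with h | h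
          · exact h
          · exact absurd (hL h) (mem_sdiff.1 hx).2
        · intro x hx
          have := h (mem_inter.1 hx).1
          rcases mem_union.1 this with h | h
          · exact absurd (mem_inter.1 hx).2 (disjoint_left.1 hT h)
          · exact h
      · rintro ⟨h1, h2⟩ x hx
        by_cases hxS : x ∈ S
        · exact mem_union_right _ (h2 (mem_inter.2 ⟨hx, hxS⟩))
        · exact mem_union_left _ (h1 (mem_sdiff.2 ⟨hx, hxS⟩))
    rw [unanimity_apply]
    simp [hA, this]
  rw [derivative, sum_congr rfl h0]
  by_cases h1 : A \ S ⊆ T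
  swap
  · simp [h1]
  simp only [h1, true_and, and_true]
  rw [← sum_filter]
  have h2 : ∑ L ∈ S.powerset.filter (fun L => A ∩ S ⊆ L), (-1 : ℝ) ^ (S.card - L.card) =
      ∑ M ∈ (S \ A).powerset, (-1 : ℝ) ^ M.card := by
    refine sum_bij' (fun L _ => S \ L) (fun M _ => S \ M) ?_ ?_ ?_ ?_ ?_
    · intro L hL
      simp only [mem_filter, mem_powerset] at hL ⊢
      intro x hx
      have hx := mem_sdiff.1 hx
      exact mem_sdiff.2 ⟨hx.1, fun hxA => hx.2 (hL.2 (mem_inter.2 ⟨hxA, hx.1⟩))⟩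
    · intro M hM
      simp only [mem_filter, mem_powerset] at hM ⊢
      refine ⟨sdiff_subset, fun x hx => ?_⟩
      have hx := mem_inter.1 hx
      exact mem_sdiff.2 ⟨hx.2, fun hxM => (mem_sdiff.1 (hM hxM)).2 hx.1⟩
    · intro L hL
      simp only [mem_filter, mem_powerset] at hL
      exact Finset.sdiff_sdiff_eq_self hL.1
    · intro M hM
      exact Finset.sdiff_sdiff_eq_self ((mem_powerset.1 hM).trans sdiff_subset)
    · intro L hL
      simp only [mem_filter, mem_powerset] at hL
      rw [card_sdiff_of_subset hL.1]
  rw [h2]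
  have h3 := Finset.sum_powerset_neg_one_pow_card (x := S \ A)
  have h4 : ∑ M ∈ (S \ A).powerset, (-1 : ℝ) ^ M.card = if S \ A = ∅ then 1 else 0 := by
    exact_mod_cast h3
  rw [h4]
  simp [sdiff_eq_empty_iff_subset]

/-- The `r`-th term is a constant times `(r + k).choose k`, so the hockey-stick identity evaluates
the sum. It is used with `m = |V| - |S|` and `k = |A \ S|`. -/
theorem sum_weights (m k : ℕ) (hk : k ≤ m) :
    ∑ r ∈ range (m - k + 1), ((m - k).choose r : ℝ) *
      (((m - (k + r))! : ℝ) * ((k + r)! : ℝ) / ((m + 1)! : ℝ)) = 1 / (k + 1) := by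
  have h1 : ∀ r ∈ range (m - k + 1), ((m - k).choose r : ℝ) *
      (((m - (k + r))! : ℝ) * ((k + r)! : ℝ) / ((m + 1)! : ℝ)) =
      ((m - k)! * k ! : ℝ) / ((m + 1)! : ℝ) * ((r + k).choose k : ℝ) := by
    intro r hr
    have hr : r ≤ m - k := by simpa [Nat.lt_succ_iff] using hr
    have e1 : m - (k + r) = m - k - r := by omega
    have e2 := Nat.choose_mul_factorial_mul_factorial hr
    have e3 := Nat.add_choose_mul_factorial_mul_factorial r k
    rw [e1, add_comm k r, ← e2, ← e3]
    have : ((r ! : ℕ) : ℝ) ≠ 0 := by positivity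
    push_cast
    ring
  rw [sum_congr rfl h1, ← mul_sum]
  have h2 : ∑ r ∈ range (m - k + 1), ((r + k).choose k : ℝ) = ((m + 1).choose (k + 1) : ℝ) := by
    have := Nat.sum_range_add_choose (m - k) k
    rw [show m - k + k + 1 = m + 1 by omega] at this
    exact_mod_cast this
  rw [h2]
  have h3 := Nat.choose_mul_factorial_mul_factorial (show k + 1 ≤ m + 1 by omega)
  rw [show m + 1 - (k + 1) = m - k by omega, Nat.factorial_succ k] at h3
  rw [← h3]
  have a1 : ((m + 1).choose (k + 1) : ℝ) ≠ 0 := by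
    exact_mod_cast (Nat.choose_pos (by omega)).ne'
  have a2 : ((m - k)! : ℝ) ≠ 0 := by positivity
  have a3 : (k ! : ℝ) ≠ 0 := by positivity
  have a4 : (k + 1 : ℝ) ≠ 0 := by positivity
  push_cast
  field_simp

/-! ### The Shapley interaction index in terms of dividends -/

variable [Fintype V]

theorem shapleyIndex_unanimity {A : Finset V} (hA : A.Nonempty) (S : Coalition V) :
    shapleyIndex (unanimity A) S = if S.1 ⊆ A then 1 / ((A \ S.1).card + 1 : ℝ) else 0 := by
  have h0 : ∀ T ∈ (S.1ᶜ).powerset, derivative (unanimity A) S.1 T =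
      if S.1 ⊆ A ∧ A \ S.1 ⊆ T then 1 else 0 := fun T hT =>
    derivative_unanimity hA (disjoint_left.2 fun x hx => mem_compl.1 (mem_powerset.1 hT hx))
  rw [shapleyIndex, sum_congr rfl fun T hT => by rw [h0 T hT]]
  split_ifs with hS
  swap
  · simp [hS]
  simp only [hS, true_and, mul_ite, mul_one, mul_zero]
  rw [← sum_filter]
  set k := (A \ S.1).card with hk
  set m := Fintype.card V - S.1.card with hm
  have hsub : A \ S.1 ⊆ S.1ᶜ := fun x hx => mem_compl.2 (mem_sdiff.1 hx).2
  have hmc : (S.1ᶜ).card = m := by rw [card_compl]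
  have hkm : k ≤ m := by rw [← hmc]; exact card_le_card hsub
  rw [← sum_weights m k hkm]
  have hB : (S.1ᶜ \ (A \ S.1)).card = m - k := by rw [card_sdiff_of_subset hsub, hmc]
  -- The contributing `T` are the sets `(A \ S) ∪ U` with `U` among the other `m - k` players
  -- outside `S`. They are grouped by `r = |U|`.
  have h1 := sum_powerset_apply_card (x := S.1ᶜ \ (A \ S.1)) (fun r : ℕ =>
    (((m - (k + r))! : ℝ) * ((k + r)! : ℝ) / ((m + 1)! : ℝ)))
  simp only [hB, nsmul_eq_mul] at h1
  rw [← h1]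
  refine sum_bij' (fun T _ => T \ (A \ S.1)) (fun U _ => U ∪ (A \ S.1)) ?_ ?_ ?_ ?_ ?_
  · intro T hT
    simp only [mem_filter, mem_powerset] at hT ⊢
    exact sdiff_subset_sdiff hT.1 subset_rfl
  · intro U hU
    simp only [mem_filter, mem_powerset] at hU ⊢
    exact ⟨union_subset (hU.trans sdiff_subset) hsub, subset_union_right⟩
  · intro T hT
    simp only [mem_filter, mem_powerset] at hT
    exact sdiff_union_of_subset hT.2
  · intro U hU
    have hU := mem_powerset.1 hU
    exact union_sdiff_cancel_right (disjoint_left.2 fun x hx => (mem_sdiff.1 (hU hx)).2)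
  · intro T hT
    simp only [mem_filter, mem_powerset] at hT
    have h2 : k + (T \ (A \ S.1)).card = T.card := by
      rw [add_comm]; exact card_sdiff_add_card_eq_card hT.2
    rw [h2]
    have : Fintype.card V - T.card - S.1.card = m - T.card := by omega
    rw [this]

theorem shapleyIndex_add (v w : Game V) (S : Coalition V) :
    shapleyIndex (v + w) S = shapleyIndex v S + shapleyIndex w S := by
  simp only [shapleyIndex, derivative, ← sum_add_distrib, ← mul_add]
  rfl

theorem shapleyIndex_smul (c : ℝ) (v : Game V) (S : Coalition V) :
    shapleyIndex (c • v) S = c * shapleyIndex v S := by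
  simp only [shapleyIndex, derivative, mul_sum]
  refine sum_congr rfl fun T _ => sum_congr rfl fun L _ => ?_
  change _ * (_ * (c * v.1 (T ∪ L))) = _
  ring

/-- The Shapley interaction index in terms of dividends. -/
theorem shapleyIndex_eq_sum_dividend (v : Game V) (S : Coalition V) :
    shapleyIndex v S = ∑ T with S.1 ⊆ T, dividend v.1 T / ((T \ S.1).card + 1 : ℝ) := by
  let L : Game V →ₗ[ℝ] ℝ :=
    { toFun := fun v => shapleyIndex v S
      map_add' := fun v w => shapleyIndex_add v w S
      map_smul' := fun c v => shapleyIndex_smul c v S }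
  have h : L v = ∑ T : Finset V, dividend v.1 T * L (unanimity T) := by
    conv_lhs => rw [game_eq_sum_unanimity v]
    rw [map_sum]
    exact sum_congr rfl fun T _ => by rw [map_smul, smul_eq_mul]
  change L v = _
  rw [h, sum_filter]
  refine sum_congr rfl fun T _ => ?_
  rcases T.eq_empty_or_nonempty with rfl | hne
  · simp [dividend_empty]
  · change _ * shapleyIndex (unanimity T) S = _
    rw [shapleyIndex_unanimity hne]
    split_ifs
    · ring
    · ring

end Dividends

/-! ### Components and the graph-restricted game -/

section Components

variable {V : Type*} {Γ : SimpleGraph V} {S A R : Finset V} {i j k : V}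

/-- Walks become chains in `V` itself instead of a subtype, so that `S` can be changed without
transporting vertices. -/
theorem connIn_iff : ConnIn Γ S i j ↔ i ∈ S ∧ j ∈ S ∧
    Relation.ReflTransGen (fun a b => a ∈ S ∧ b ∈ S ∧ Γ.Adj a b) i j := by
  constructor
  · rintro ⟨hi, hj, h⟩
    rw [SimpleGraph.reachable_iff_reflTransGen] at h
    refine ⟨hi, hj, h.lift Subtype.val fun a b hab => ⟨?_, ?_, hab⟩⟩
    · exact mem_coe.1 a.2
    · exact mem_coe.1 b.2
  · rintro ⟨hi, hj, h⟩
    refine ⟨hi, hj, ?_⟩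
    induction h with
    | refl => exact SimpleGraph.Reachable.refl _
    | tail _ hbc ih =>
      exact (ih hbc.1).trans (SimpleGraph.Adj.reachable (by exact hbc.2.2))

theorem ConnIn.refl (hi : i ∈ S) : ConnIn Γ S i i :=
  connIn_iff.2 ⟨hi, hi, .refl⟩

theorem ConnIn.left_mem (h : ConnIn Γ S i j) : i ∈ S := (connIn_iff.1 h).1

theorem ConnIn.right_mem (h : ConnIn Γ S i j) : j ∈ S := (connIn_iff.1 h).2.1

theorem ConnIn.symm (h : ConnIn Γ S i j) : ConnIn Γ S j i := by
  obtain ⟨hi, hj, h⟩ := h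
  exact ⟨hj, hi, h.symm⟩

theorem ConnIn.trans (h : ConnIn Γ S i j) (h' : ConnIn Γ S j k) : ConnIn Γ S i k := by
  obtain ⟨hi, _, h⟩ := h
  obtain ⟨_, hk, h'⟩ := h'
  exact ⟨hi, hk, SimpleGraph.Reachable.trans h h'⟩

theorem ConnIn.of_adj (hi : i ∈ S) (hj : j ∈ S) (h : Γ.Adj i j) : ConnIn Γ S i j :=
  connIn_iff.2 ⟨hi, hj, .single ⟨hi, hj, h⟩⟩

theorem ConnIn.mono (h : ConnIn Γ R i j) (hRS : R ⊆ S) : ConnIn Γ S i j := by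
  obtain ⟨hi, hj, h⟩ := connIn_iff.1 h
  exact connIn_iff.2 ⟨hRS hi, hRS hj,
    h.lift id fun a b hab => ⟨hRS hab.1, hRS hab.2.1, hab.2.2⟩⟩

/-- A path inside `S` that starts in `A` can never leave `A`. -/
theorem ConnIn.of_closed (h : ConnIn Γ S i j) (hi : i ∈ A)
    (hcl : ∀ a ∈ A, ∀ b ∈ S, Γ.Adj a b → b ∈ A) : ConnIn Γ A i j := by
  replace h := (connIn_iff.1 h).2.2
  induction h with
  | refl => exact .refl hi
  | tail _ hbc ih =>
    exact ih.trans (.of_adj ih.right_mem (hcl _ ih.right_mem _ hbc.2.1 hbc.2.2) hbc.2.2)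

theorem mem_componentOf : j ∈ componentOf Γ S i ↔ ConnIn Γ S i j := by
  classical
  simp only [componentOf, mem_filter, and_iff_right_iff_imp]
  exact fun h => h.right_mem

theorem componentOf_subset : componentOf Γ S i ⊆ S := fun _ h => (mem_componentOf.1 h).right_mem

theorem componentOf_closed : ∀ a ∈ componentOf Γ S i, ∀ b ∈ S, Γ.Adj a b →
    b ∈ componentOf Γ S i := fun _ ha _ hb hab =>
  mem_componentOf.2 ((mem_componentOf.1 ha).trans (.of_adj (mem_componentOf.1 ha).right_mem hb hab))

theorem connIn_componentOf (hj : j ∈ componentOf Γ S i) (hk : k ∈ componentOf Γ S i) :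
    ConnIn Γ (componentOf Γ S i) j k :=
  ((mem_componentOf.1 hj).symm.trans (mem_componentOf.1 hk)).of_closed hj componentOf_closed

theorem componentOf_eq_of_closed (hA : A ⊆ S) (hi : i ∈ A)
    (hcl : ∀ a ∈ A, ∀ b ∈ S, Γ.Adj a b → b ∈ A) : componentOf Γ S i = componentOf Γ A i := by
  ext j
  rw [mem_componentOf, mem_componentOf]
  exact ⟨fun h => h.of_closed hi hcl, fun h => h.mono hA⟩

theorem connIn_comap {W : Type*} (ι : W ↪ V) {T : Finset W} {a b : W} :
    ConnIn (Γ.comap ι) T a b ↔ ConnIn Γ (T.map ι) (ι a) (ι b) := by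
  constructor
  · intro h
    obtain ⟨ha, hb, h⟩ := connIn_iff.1 h
    refine connIn_iff.2 ⟨mem_map_of_mem ι ha, mem_map_of_mem ι hb, h.lift ι fun c d hcd => ?_⟩
    exact ⟨mem_map_of_mem ι hcd.1, mem_map_of_mem ι hcd.2.1, hcd.2.2⟩
  · intro h
    obtain ⟨ha, hb, h⟩ := connIn_iff.1 h
    have ha : a ∈ T := (mem_map' ι).1 ha
    suffices ∀ c, Relation.ReflTransGen (fun a b => a ∈ T.map ι ∧ b ∈ T.map ι ∧ Γ.Adj a b) (ι a) c →
        ∃ d, ι d = c ∧ ConnIn (Γ.comap ι) T a d by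
      obtain ⟨d, hd, h'⟩ := this _ h
      rwa [ι.injective hd] at h'
    intro c hc
    induction hc with
    | refl => exact ⟨a, rfl, .refl ha⟩
    | tail _ hbc ih =>
      obtain ⟨d, rfl, hd⟩ := ih
      obtain ⟨e, he, rfl⟩ := mem_map.1 hbc.2.1
      exact ⟨e, rfl, hd.trans (.of_adj hd.right_mem he hbc.2.2)⟩

variable [DecidableEq V]

theorem mem_components {K : Finset V} :
    K ∈ components Γ S ↔ ∃ i ∈ S, componentOf Γ S i = K := mem_image

theorem componentOf_mem_components (hi : i ∈ S) : componentOf Γ S i ∈ components Γ S :=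
  mem_components.2 ⟨i, hi, rfl⟩

theorem components_split (hA : A ⊆ S) (hcl : ∀ a ∈ A, ∀ b ∈ S, Γ.Adj a b → b ∈ A) :
    components Γ S = components Γ A ∪ components Γ (S \ A) := by
  have hcl' : ∀ a ∈ S \ A, ∀ b ∈ S, Γ.Adj a b → b ∈ S \ A := fun a ha b hb hab =>
    mem_sdiff.2 ⟨hb, fun hbA => (mem_sdiff.1 ha).2 (hcl b hbA a (mem_sdiff.1 ha).1 hab.symm)⟩
  conv_lhs => rw [components, ← union_sdiff_of_subset hA, image_union]
  rw [union_sdiff_of_subset hA]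
  congr 1
  · exact image_congr fun i hi => componentOf_eq_of_closed hA hi hcl
  · exact image_congr fun i hi => componentOf_eq_of_closed sdiff_subset hi hcl'

theorem restrictedGame_apply (v : Game V) (Γ : SimpleGraph V) (S : Finset V) :
    (restrictedGame v Γ).1 S = ∑ C ∈ components Γ S, v.1 C := rfl

/-- No edge of `Γ_S` joins `A` to `S \ A`, so every component of `Γ_S` lies on one side. This
additivity is the main tool for restricted games. -/
theorem restrictedGame_split (v : Game V) (hA : A ⊆ S)
    (hcl : ∀ a ∈ A, ∀ b ∈ S, Γ.Adj a b → b ∈ A) : (restrictedGame v Γ).1 S =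
      (restrictedGame v Γ).1 A + (restrictedGame v Γ).1 (S \ A) := by
  rw [restrictedGame_apply, components_split hA hcl, sum_union]
  · rfl
  · refine disjoint_left.2 fun K hK hK' => ?_
    obtain ⟨i, hi, rfl⟩ := mem_components.1 hK
    obtain ⟨j, _, h⟩ := mem_components.1 hK'
    have hi' : i ∈ componentOf Γ (S \ A) j := by
      rw [h]; exact mem_componentOf.2 (.refl hi)
    exact (mem_sdiff.1 (componentOf_subset hi')).2 hi

theorem restrictedGame_of_connected (v : Game V) (h : ∀ i ∈ S, ∀ j ∈ S, ConnIn Γ S i j) :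
    (restrictedGame v Γ).1 S = v.1 S := by
  rcases S.eq_empty_or_nonempty with rfl | ⟨i, hi⟩
  · exact (show (restrictedGame v Γ).1 ∅ = 0 from (restrictedGame v Γ).2).trans
      (show v.1 ∅ = 0 from v.2).symm
  · have hS : ∀ j ∈ S, componentOf Γ S j = S := fun j hj =>
      componentOf_subset.antisymm fun k hk => mem_componentOf.2 (h j hj k hk)
    have : components Γ S = {S} := by
      ext K
      rw [mem_components, mem_singleton]
      constructor
      · rintro ⟨j, hj, rfl⟩
        exact hS j hj
      · rintro rfl
        exact ⟨i, hi, hS i hi⟩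
    rw [restrictedGame_apply, this, sum_singleton]

theorem restrictedGame_componentOf (v : Game V) : (restrictedGame v Γ).1 S =
    v.1 (componentOf Γ S i) + (restrictedGame v Γ).1 (S \ componentOf Γ S i) := by
  rw [restrictedGame_split v componentOf_subset (componentOf_closed (i := i)),
    restrictedGame_of_connected v fun j hj k hk => connIn_componentOf hj hk]

theorem restrictedGame_eq_zero {v : Game V} (h : ∀ C ⊆ S, v.1 C = 0) :
    (restrictedGame v Γ).1 S = 0 := by
  refine sum_eq_zero fun C hC => ?_
  obtain ⟨i, _, rfl⟩ := mem_components.1 hC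
  exact h _ componentOf_subset

/-- A component of the whole graph splits the graph-restricted game. -/
theorem restrictedGame_split_component [Fintype V] (v : Game V) {C : Finset V}
    (hC : C ∈ components Γ univ) (S : Finset V) : (restrictedGame v Γ).1 S =
      (restrictedGame v Γ).1 (S ∩ C) + (restrictedGame v Γ).1 (S \ C) := by
  obtain ⟨i, _, rfl⟩ := mem_components.1 hC
  rw [restrictedGame_split v (A := S ∩ componentOf Γ univ i) inter_subset_left,
    sdiff_inter_self_left]
  intro a ha b hb hab
  exact mem_inter.2 ⟨hb, componentOf_closed a (mem_inter.1 ha).2 b (mem_univ b) hab⟩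

theorem component_nonempty {C : Finset V} (hC : C ∈ components Γ S) : C.Nonempty := by
  obtain ⟨i, hi, rfl⟩ := mem_components.1 hC
  exact ⟨i, mem_componentOf.2 (.refl hi)⟩

theorem component_connected {C : Finset V} (hC : C ∈ components Γ S) :
    ∀ i ∈ C, ∀ j ∈ C, ConnIn Γ C i j := by
  obtain ⟨i, hi, rfl⟩ := mem_components.1 hC
  exact fun j hj k hk => connIn_componentOf hj hk

theorem restrictedGame_component (v : Game V) {C : Finset V} (hC : C ∈ components Γ S) :
    (restrictedGame v Γ).1 C = v.1 C :=
  restrictedGame_of_connected v (component_connected hC)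

/-- Two graphs with the same edges inside `S` have the same restricted worth of `S`. -/
theorem restrictedGame_congr (v : Game V) {Γ' : SimpleGraph V}
    (h : ∀ a ∈ S, ∀ b ∈ S, Γ.Adj a b ↔ Γ'.Adj a b) :
    (restrictedGame v Γ).1 S = (restrictedGame v Γ').1 S := by
  have h1 : ∀ i j, ConnIn Γ S i j ↔ ConnIn Γ' S i j := by
    intro i j
    rw [connIn_iff, connIn_iff]
    have : (fun a b => a ∈ S ∧ b ∈ S ∧ Γ.Adj a b) = fun a b => a ∈ S ∧ b ∈ S ∧ Γ'.Adj a b := by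
      funext a b
      refine propext (and_congr_right fun ha => and_congr_right fun hb => h a ha b hb)
    rw [this]
  have h2 : componentOf Γ S = componentOf Γ' S := by
    funext i
    ext j
    rw [mem_componentOf, mem_componentOf, h1]
  rw [restrictedGame_apply, restrictedGame_apply, components, components, h2]

variable {W : Type*} [DecidableEq W]

theorem restrictedGame_restrictTo (v : Game V) (Γ : SimpleGraph V) (ι : W ↪ V) :
    restrictedGame (restrictTo v ι) (Γ.comap ι) = restrictTo (restrictedGame v Γ) ι := by
  refine Subtype.ext (funext fun T => ?_)
  change ∑ C ∈ components (Γ.comap ι) T, v.1 (C.map ι) = ∑ C ∈ components Γ (T.map ι), v.1 C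
  have h1 : ∀ a, (componentOf (Γ.comap ι) T a).map ι = componentOf Γ (T.map ι) (ι a) := by
    intro a
    ext c
    rw [mem_map, mem_componentOf]
    constructor
    · rintro ⟨b, hb, rfl⟩
      exact (connIn_comap ι).1 (mem_componentOf.1 hb)
    · intro hc
      obtain ⟨b, _, rfl⟩ := mem_map.1 hc.right_mem
      exact ⟨b, mem_componentOf.2 ((connIn_comap ι).2 hc), rfl⟩
  have h2 : components Γ (T.map ι) = (components (Γ.comap ι) T).image (Finset.map ι) := by
    rw [components, components, image_image, map_eq_image, image_image]
    refine image_congr fun a _ => ?_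
    rw [Function.comp_apply, Function.comp_apply, h1, map_eq_image]
  rw [h2, sum_image fun A _ B _ h => map_injective ι h]

end Components

/-! ### Intermediaries -/

section Intermediaries

variable {V : Type*} {Γ : SimpleGraph V}

theorem connects_of_mem_minimalConnecting [Fintype V] {R S : Finset V}
    (h : R ∈ minimalConnecting Γ S) : Connects Γ R S := by
  simp only [minimalConnecting, mem_filter, mem_univ, true_and] at h
  exact h.1

theorem exists_minimalConnecting [Fintype V] {K S : Finset V} (h : Connects Γ K S) :
    ∃ R ∈ minimalConnecting Γ S, R ⊆ K := by
  induction K using Finset.strongInduction with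
  | H K ih =>
    by_cases hK : ∃ R' ⊂ K, Connects Γ R' S
    · obtain ⟨R', hR', hc⟩ := hK
      obtain ⟨R, hR, hRR⟩ := ih R' hR' hc
      exact ⟨R, hR, hRR.trans hR'.1⟩
    · refine ⟨K, ?_, subset_rfl⟩
      simp only [minimalConnecting, mem_filter, mem_univ, true_and]
      exact ⟨h, fun R' hR' hc => hK ⟨R', hR', hc⟩⟩

variable [DecidableEq V]

/-- Any connecting set contains a minimal one, and essential intermediaries lie in all minimal ones.
-/
theorem union_essentialIntermediaries_subset [Fintype V] {K P : Finset V}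
    (h : Connects Γ K P) : P ∪ essentialIntermediaries Γ P ⊆ K := by
  obtain ⟨R, hR, hRK⟩ := exists_minimalConnecting h
  refine union_subset h.1 fun i hi => hRK ?_
  simp only [essentialIntermediaries, mem_filter] at hi
  exact hi.2 R hR

theorem eq_zero_of_isVetoPartnership {v : Game V} {P : Finset V} (hP : IsVetoPartnership v P)
    {S : Finset V} (hS : ¬ P ⊆ S) : v.1 S = 0 := by
  have h := hP.2 (S \ P) (S ∩ P) sdiff_disjoint
    ⟨inter_subset_right, fun h => hS (h.trans inter_subset_left)⟩
  rw [sdiff_union_inter] at h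
  rw [h.1, h.2]

/-- A component with non-zero worth contains the veto partnership `P`. Being connected, it connects
`P`, so it also contains the essential intermediaries of `P`, and hence `Q`. -/
theorem restrictedGame_eq_zero_of_isVetoGraphPartnership [Fintype V] {v : Game V}
    {Q : Finset V} (hQ : IsVetoGraphPartnership v Γ Q) {S : Finset V} (hS : ¬ Q ⊆ S) :
    (restrictedGame v Γ).1 S = 0 := by
  obtain ⟨_, P, hP, hQP⟩ := hQ
  refine sum_eq_zero fun C hC => eq_zero_of_isVetoPartnership hP fun hPC => hS ?_
  have : Connects Γ C P :=
    ⟨hPC, fun i hi j hj => component_connected hC i (hPC hi) j (hPC hj)⟩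
  refine (hQP.trans (union_essentialIntermediaries_subset this)).trans ?_
  obtain ⟨i, _, rfl⟩ := mem_components.1 hC
  exact componentOf_subset

end Intermediaries

/-! ### Graph null players -/

section NullPlayers

variable {V : Type*} [DecidableEq V] {Γ : SimpleGraph V}

/-- Null players do not affect the worth of a coalition. -/
theorem eq_of_null_sdiff (v : Game V) {A B : Finset V} (hAB : A ⊆ B)
    (h : ∀ i ∈ B, i ∉ A → IsNullPlayer v i) : v.1 B = v.1 A := by
  induction B using Finset.strongInduction with
  | H B ih =>
    by_cases hBA : B ⊆ A
    · rw [hBA.antisymm hAB]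
    · obtain ⟨i, hiB, hiA⟩ := not_subset.1 hBA
      have h1 := h i hiB hiA (B.erase i) (notMem_erase i B)
      rw [insert_erase hiB] at h1
      rw [h1, ih _ (erase_ssubset hiB) (fun x hx => mem_erase.2 ⟨fun e => hiA (e ▸ hx), hAB hx⟩)
        fun j hj => h j (mem_of_mem_erase hj)]

/-- A graph null player is a null player of the graph-restricted game. -/
theorem isNullPlayer_restrictedGame [Fintype V] {v : Game V} {i : V} (h : IsGraphNull v Γ i) :
    IsNullPlayer (restrictedGame v Γ) i := by
  have hz : ∀ C : Finset V, (∀ j ∈ C, IsNullPlayer v j) → v.1 C = 0 := fun C hC =>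
    (eq_of_null_sdiff v (empty_subset C) fun j hj _ => hC j hj).trans v.2
  intro S hi
  -- Adding `i` only affects its component `K`. As `i` is null in `v`, it remains to see that
  -- `K.erase i` has the same worth in `v` and in the restricted game.
  set K := componentOf Γ (insert i S) i with hK
  have hiK : i ∈ K := mem_componentOf.2 (.refl (mem_insert_self i S))
  have hKS : K.erase i ⊆ S := fun x hx =>
    (mem_insert.1 (componentOf_subset (mem_erase.1 hx).2)).resolve_left (mem_erase.1 hx).1
  have h1 : (restrictedGame v Γ).1 (insert i S) = v.1 K + (restrictedGame v Γ).1 (S \ K) := by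
    rw [restrictedGame_componentOf v (i := i), insert_sdiff_of_mem _ hiK]
  have h2 : (restrictedGame v Γ).1 S =
      (restrictedGame v Γ).1 (K.erase i) + (restrictedGame v Γ).1 (S \ K) := by
    have e : S \ K.erase i = S \ K := by
      ext x
      simp only [mem_sdiff, mem_erase, not_and]
      refine and_congr_right fun hx => ⟨fun h => h fun e => hi (e ▸ hx), fun h _ => h⟩
    rw [restrictedGame_split v hKS, e]
    · intro a ha b hb hab
      exact mem_erase.2 ⟨fun e => hi (e ▸ hb),
        componentOf_closed a (mem_erase.1 ha).2 b (mem_insert_of_mem hb) hab⟩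
  have h3 : v.1 K = v.1 (K.erase i) := by
    have := h.1 (K.erase i) (notMem_erase i K)
    rwa [insert_erase hiK] at this
  rw [h1, h2, h3]
  congr 1
  symm
  by_cases hA : ∀ j ∈ K.erase i, IsNullPlayer v j
  · rw [hz _ hA]
    exact restrictedGame_eq_zero fun C hC => hz C fun j hj => hA j (hC hj)
  · push Not at hA
    obtain ⟨j, hj, hjn⟩ := hA
    -- If `j` and `k` are connected in `K` but not in `K.erase i`, each minimal connecting set of
    -- `{j, k}` inside `K` uses `i`. Thus `i` is an intermediary of the pair, and since `j` is not
    -- null, `k` is. All worth of `K.erase i` sits in the component of `j`.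
    have key : ∀ k ∈ K.erase i, k ∉ componentOf Γ (K.erase i) j → IsNullPlayer v k := by
      intro k hk hkj
      rw [mem_componentOf] at hkj
      have hne : j ≠ k := fun e => hkj (e ▸ .refl hj)
      refine (h.2 j k (mem_erase.1 hj).1 (mem_erase.1 hk).1 hne ?_).resolve_left hjn
      have hjK := (mem_erase.1 hj).2
      have hkK := (mem_erase.1 hk).2
      have hc : Connects Γ K {j, k} := by
        have hsub : ({j, k} : Finset V) ⊆ K := by
          intro x hx
          rcases mem_insert.1 hx with rfl | hx
          · exact hjK
          · rwa [mem_singleton.1 hx]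
        exact ⟨hsub, fun a ha b hb => connIn_componentOf (hsub ha) (hsub hb)⟩
      obtain ⟨R, hR, hRK⟩ := exists_minimalConnecting hc
      refine mem_sdiff.2 ⟨mem_biUnion.2 ⟨R, hR, ?_⟩, ?_⟩
      · by_contra hiR
        refine hkj (((connects_of_mem_minimalConnecting hR).2 j (by simp) k (by simp)).mono ?_)
        exact fun x hx => mem_erase.2 ⟨fun e => hiR (e ▸ hx), hRK hx⟩
      · rw [mem_insert, mem_singleton]
        rintro (rfl | rfl)
        · exact (mem_erase.1 hj).1 rfl
        · exact (mem_erase.1 hk).1 rfl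
    rw [restrictedGame_componentOf v (i := j), eq_of_null_sdiff v componentOf_subset key,
      restrictedGame_eq_zero, add_zero]
    exact fun C hC => hz C fun k hk => key k (mem_sdiff.1 (hC hk)).1 (mem_sdiff.1 (hC hk)).2

end NullPlayers

/-! ### The properties of the Myerson interaction index -/

theorem myersonIndex_linearity : Linearity myersonIndex := by
  intro N a₁ a₂ v₁ v₂ Γ S
  have h : restrictedGame (a₁ • v₁ + a₂ • v₂) Γ =
      a₁ • restrictedGame v₁ Γ + a₂ • restrictedGame v₂ Γ := by
    refine Subtype.ext (funext fun T => ?_)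
    change ∑ C ∈ components Γ T, (a₁ * v₁.1 C + a₂ * v₂.1 C) =
      a₁ * ∑ C ∈ components Γ T, v₁.1 C + a₂ * ∑ C ∈ components Γ T, v₂.1 C
    rw [sum_add_distrib, mul_sum, mul_sum]
  rw [myersonIndex, h, shapleyIndex_add, shapleyIndex_smul, shapleyIndex_smul]
  rfl

theorem myersonIndex_graphNull : GraphNull myersonIndex := by
  intro N v Γ i hi S _
  rw [myersonIndex, shapleyIndex_eq_sum_dividend]
  refine sum_eq_zero fun T hT => ?_
  rw [dividend_eq_zero_of_null _ (isNullPlayer_restrictedGame hi)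
    ((mem_filter.1 hT).2 (mem_insert_self i S)), zero_div]

/-- The restricted game is the sum of its parts on `C` and off `C`, so coalitions meeting both have
no dividend. -/
theorem dividend_restrictedGame_eq_zero {V : Type*} [Fintype V] [DecidableEq V] (v : Game V)
    {Γ : SimpleGraph V} {C : Finset V} (hC : C ∈ components Γ univ) {T : Finset V} {i : V}
    (hi : i ∈ T) (hiC : i ∈ C) (hT : ¬ T ⊆ C) : dividend (restrictedGame v Γ).1 T = 0 := by
  obtain ⟨j, hj, hjC⟩ := not_subset.1 hT
  exact dividend_eq_zero_of_split _ C (restrictedGame_split_component v hC) hi hj hiC hjC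

/-- On singletons each dividend is shared equally among the members of its coalition. Summing over
`C` returns every dividend inside `C` once, which gives the restricted worth of `C`. -/
theorem myersonIndex_componentEfficiency : ComponentEfficiency myersonIndex := by
  intro N v Γ C hC
  simp only [myersonIndex, shapleyIndex_eq_sum_dividend, singleton_subset_iff]
  set a := dividend (restrictedGame v Γ).1 with ha
  have h1 : ∀ i ∈ C, ∑ T with i ∈ T, a T / ((T \ {i}).card + 1 : ℝ) =
      ∑ T ∈ C.powerset, if i ∈ T then a T / (T.card : ℝ) else 0 := by
    intro i hi
    rw [← sum_filter]
    have h2 : ∀ T ∈ (univ.filter fun T : Finset N => i ∈ T),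
        a T / ((T \ {i}).card + 1 : ℝ) = a T / (T.card : ℝ) := by
      intro T hT
      have hiT := (mem_filter.1 hT).2
      have : (T \ {i}).card + 1 = T.card := by
        rw [sdiff_singleton_eq_erase]; exact card_erase_add_one hiT
      rw [← this]; push_cast; rfl
    rw [sum_congr rfl h2]
    symm
    refine sum_subset (filter_subset_filter _ (subset_univ _)) fun T hT hT' => ?_
    have hiT := (mem_filter.1 hT).2
    rw [ha, dividend_restrictedGame_eq_zero v hC hiT hi, zero_div]
    exact fun h => hT' (mem_filter.2 ⟨mem_powerset.2 h, hiT⟩)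
  rw [sum_congr rfl h1, sum_comm, ← restrictedGame_component v hC,
    ← sum_dividend (restrictedGame v Γ).1]
  refine sum_congr rfl fun T hT => ?_
  rw [← sum_filter, sum_const, filter_mem_eq_inter, inter_eq_right.2 (mem_powerset.1 hT),
    nsmul_eq_mul]
  rcases T.eq_empty_or_nonempty with rfl | hne
  · simp [dividend_empty]
  · have : (T.card : ℝ) ≠ 0 := by exact_mod_cast hne.card_pos.ne'
    field_simp
    rfl

/-- Removing the edge does not change the subgraph induced by a coalition missing `i` or `j`. So
only dividends of `T ⊇ {i, j}` survive in the difference `w`, and these enter the indices of `S ∪ i`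
and `S ∪ j` with equal weights. -/
theorem myersonIndex_fairness : Fairness myersonIndex := by
  intro N v Γ i j hij S hi hj
  have hne : i ≠ j := hij.ne
  set Γ' := Γ.deleteEdges {s(i, j)} with hΓ'
  set w : Game N := restrictedGame v Γ + (-1 : ℝ) • restrictedGame v Γ' with hw
  have hsub : ∀ T : Coalition N, shapleyIndex w T = myersonIndex N v Γ T - myersonIndex N v Γ' T := by
    intro T
    rw [hw, shapleyIndex_add, shapleyIndex_smul, myersonIndex, myersonIndex]
    ring
  rw [← hsub, ← hsub, shapleyIndex_eq_sum_dividend, shapleyIndex_eq_sum_dividend]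
  have hzero : ∀ T, ¬ ({i, j} : Finset N) ⊆ T → w.1 T = 0 := by
    intro T hT
    change (restrictedGame v Γ).1 T + (-1 : ℝ) * (restrictedGame v Γ').1 T = 0
    rw [restrictedGame_congr v (Γ := Γ) (Γ' := Γ')]
    · ring
    · intro a ha b hb
      rw [hΓ', SimpleGraph.deleteEdges_adj]
      refine ⟨fun h => ⟨h, fun hab => hT ?_⟩, fun h => h.1⟩
      rw [Set.mem_singleton_iff, Sym2.eq_iff] at hab
      rw [insert_subset_iff, singleton_subset_iff]
      rcases hab with ⟨rfl, rfl⟩ | ⟨rfl, rfl⟩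
      · exact ⟨ha, hb⟩
      · exact ⟨hb, ha⟩
  rw [sum_filter, sum_filter]
  refine sum_congr rfl fun T _ => ?_
  by_cases hT : ({i, j} : Finset N) ⊆ T
  · rw [insert_subset_iff, singleton_subset_iff] at hT
    simp only [insert_subset_iff, hT.1, hT.2, true_and]
    split_ifs with hS
    · rw [card_sdiff_of_subset (insert_subset hT.1 hS), card_sdiff_of_subset (insert_subset hT.2 hS),
        card_insert_of_notMem hi, card_insert_of_notMem hj]
    · rfl
  · rw [dividend_eq_zero_of_not_subset hzero hT]
    simp

theorem dividend_restrictTo {V W : Type*} [DecidableEq V] [DecidableEq W] (w : Game V)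
    (ι : W ↪ V) (T : Finset W) : dividend (restrictTo w ι).1 T = dividend w.1 (T.map ι) := by
  have : (fun T : Finset W => dividend w.1 (T.map ι)) = dividend (restrictTo w ι).1 := by
    refine eq_dividend fun S => ?_
    change _ = w.1 (S.map ι)
    rw [← sum_dividend w.1, ← sum_image fun A _ B _ h => map_injective ι h]
    refine sum_congr ?_ fun _ _ => rfl
    ext T
    simp only [mem_image, mem_powerset, subset_map_iff]
    exact ⟨fun ⟨A, h, e⟩ => ⟨A, h, e.symm⟩, fun ⟨A, h, e⟩ => ⟨A, h, e.symm⟩⟩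
  exact (congrFun this T).symm

theorem myersonIndex_isGraphInteractionIndex : IsGraphInteractionIndex myersonIndex := by
  intro N v Γ
  constructor
  · intro S hS
    rw [myersonIndex, shapleyIndex_eq_sum_dividend]
    refine sum_eq_zero fun T hT => ?_
    have hST := (mem_filter.1 hT).2
    obtain ⟨i, hi⟩ := S.2
    have hC := componentOf_mem_components (Γ := Γ) (mem_univ i)
    rw [dividend_restrictedGame_eq_zero v hC (hST hi)
      (mem_componentOf.2 (.refl (mem_univ i))) fun h => hS ⟨_, hC, hST.trans h⟩, zero_div]
  · intro C hCN hC S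
    rw [myersonIndex, myersonIndex, restrictedGame_restrictTo, shapleyIndex_eq_sum_dividend,
      shapleyIndex_eq_sum_dividend]
    obtain ⟨i, hi⟩ := S.2
    have h1 : ∑ T with S.1.map (incl hCN) ⊆ T, dividend (restrictedGame v Γ).1 T /
        ((T \ S.1.map (incl hCN)).card + 1 : ℝ) =
        ∑ T ∈ (univ.filter fun T => S.1 ⊆ T).image (Finset.map (incl hCN)),
          dividend (restrictedGame v Γ).1 T / ((T \ S.1.map (incl hCN)).card + 1 : ℝ) := by
      symm
      refine sum_subset ?_ fun T hT hT' => ?_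
      · intro T hT
        obtain ⟨A, hA, rfl⟩ := mem_image.1 hT
        exact mem_filter.2 ⟨mem_univ _, map_subset_map.2 (mem_filter.1 hA).2⟩
      · have hST := (mem_filter.1 hT).2
        rw [dividend_restrictedGame_eq_zero v hC (hST (mem_map_of_mem _ hi))
          (mem_map_of_mem _ (mem_univ i)), zero_div]
        intro h
        obtain ⟨A, _, rfl⟩ := subset_map_iff.1 h
        exact hT' (mem_image.2 ⟨A, mem_filter.2 ⟨mem_univ _, map_subset_map.1 hST⟩, rfl⟩)
    rw [h1, sum_image fun A _ B _ h => map_injective _ h]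
    refine sum_congr rfl fun T _ => ?_
    rw [dividend_restrictTo, ← Finset.map_sdiff, card_map]

/-! ### Dividends and connectivity in quotients -/

section Quotients

variable {N : Finset ℕ+} {P : Finset N} {p : ℕ+}

theorem proj_of_mem {i : N} (h : i ∈ P) : proj P p i = proxy P p := dif_pos h

theorem proj_val_of_notMem {i : N} (h : i ∉ P) : (proj P p i : ℕ+) = i := by
  rw [proj, dif_neg h]

/-- Freshness of the proxy enters here: otherwise a player outside `P` could be identified with it.
-/
theorem proj_eq_proxy_iff (hp : p ∉ (Pᶜ).map (Function.Embedding.subtype (· ∈ N))) {i : N} :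
    proj P p i = proxy P p ↔ i ∈ P := by
  refine ⟨fun h => ?_, proj_of_mem⟩
  by_contra hi
  refine hp (mem_map.2 ⟨i, mem_compl.2 hi, ?_⟩)
  have := congrArg Subtype.val h
  rw [proj_val_of_notMem hi] at this
  exact this

theorem proj_injOn {i j : N} (hi : i ∉ P) (hj : j ∉ P) (h : proj P p i = proj P p j) : i = j := by
  have := congrArg Subtype.val h
  rw [proj_val_of_notMem hi, proj_val_of_notMem hj] at this
  exact Subtype.ext this

theorem proj_surjective (hP : P.Nonempty) : Function.Surjective (proj P p) := by
  rintro ⟨a, ha⟩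
  rcases mem_insert.1 ha with rfl | h
  · obtain ⟨i, hi⟩ := hP
    exact ⟨i, proj_of_mem hi⟩
  · obtain ⟨i, hi, rfl⟩ := mem_map.1 h
    exact ⟨i, Subtype.ext (proj_val_of_notMem (mem_compl.1 hi))⟩

/-- The coalition of `N` represented by a coalition of the quotient. -/
def expand (P : Finset N) (p : ℕ+) (R : Finset (quotientPlayers P p)) : Finset N :=
  univ.filter fun i => proj P p i ∈ R

theorem mem_expand {R : Finset (quotientPlayers P p)} {i : N} :
    i ∈ expand P p R ↔ proj P p i ∈ R := by simp [expand]

theorem quotientGame_apply (v : Game N) (R : Finset (quotientPlayers P p)) :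
    (quotientGame v P p).1 R = v.1 (expand P p R) := rfl

theorem subset_expand_iff (hP : P.Nonempty) {R : Finset (quotientPlayers P p)} :
    P ⊆ expand P p R ↔ proxy P p ∈ R := by
  constructor
  · intro h
    obtain ⟨i, hi⟩ := hP
    have := mem_expand.1 (h hi)
    rwa [proj_of_mem hi] at this
  · intro h i hi
    rw [mem_expand, proj_of_mem hi]
    exact h

theorem image_expand (hP : P.Nonempty) (R : Finset (quotientPlayers P p)) :
    (expand P p R).image (proj P p) = R := by
  ext a
  rw [mem_image]
  constructor
  · rintro ⟨i, hi, rfl⟩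
    exact mem_expand.1 hi
  · intro ha
    obtain ⟨i, rfl⟩ := proj_surjective hP a
    exact ⟨i, mem_expand.2 ha, rfl⟩

/-- With `image_expand`, this gives a bijection between the coalitions containing `P` and the
quotient coalitions containing the proxy. -/
theorem expand_image (hp : p ∉ (Pᶜ).map (Function.Embedding.subtype (· ∈ N))) {T : Finset N}
    (hT : P ⊆ T) : expand P p (T.image (proj P p)) = T := by
  ext i
  rw [mem_expand, mem_image]
  constructor
  · rintro ⟨j, hj, h⟩
    by_cases hi : i ∈ P
    · exact hT hi
    · have hjP : j ∉ P := fun hjP => hi <| by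
        rw [proj_of_mem hjP] at h
        exact (proj_eq_proxy_iff hp).1 h.symm
      rwa [← proj_injOn hjP hi h]
  · exact fun hi => ⟨i, hi, rfl⟩

theorem expand_mono {R R' : Finset (quotientPlayers P p)} (h : R ⊆ R') :
    expand P p R ⊆ expand P p R' := fun _ hi => mem_expand.2 (h (mem_expand.1 hi))

theorem expand_subset_iff (hP : P.Nonempty) {R R' : Finset (quotientPlayers P p)} :
    expand P p R ⊆ expand P p R' ↔ R ⊆ R' := by
  refine ⟨fun h => ?_, expand_mono⟩
  rw [← image_expand hP R, ← image_expand hP R']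
  exact image_subset_image h

/-- If `P` is necessary for a positive worth in `w`, the dividends of the quotient of `w` are
those of `w`. -/
theorem dividend_quotientGame (hp : p ∉ (Pᶜ).map (Function.Embedding.subtype (· ∈ N)))
    (hP : P.Nonempty) {w : Game N} (hw : ∀ S, ¬ P ⊆ S → w.1 S = 0)
    (R : Finset (quotientPlayers P p)) : dividend (quotientGame w P p).1 R =
      if proxy P p ∈ R then dividend w.1 (expand P p R) else 0 := by
  have : (fun R => if proxy P p ∈ R then dividend w.1 (expand P p R) else 0) =
      dividend (quotientGame w P p).1 := by
    refine eq_dividend fun R => ?_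
    rw [quotientGame_apply, ← sum_dividend w.1, ← sum_filter]
    have h1 : ∑ T ∈ (expand P p R).powerset, dividend w.1 T =
        ∑ T ∈ (expand P p R).powerset.filter (fun T => P ⊆ T), dividend w.1 T := by
      rw [sum_filter]
      refine sum_congr rfl fun T _ => ?_
      split_ifs with h
      · rfl
      · exact dividend_eq_zero_of_not_subset hw h
    rw [h1]
    refine sum_bij' (fun R' _ => expand P p R') (fun T _ => T.image (proj P p)) ?_ ?_ ?_ ?_ ?_
    · intro R' hR'
      simp only [mem_filter, mem_powerset] at hR' ⊢
      exact ⟨expand_mono hR'.1, (subset_expand_iff hP).2 hR'.2⟩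
    · intro T hT
      simp only [mem_filter, mem_powerset] at hT ⊢
      refine ⟨?_, ?_⟩
      · rw [← image_expand hP R]
        exact image_subset_image hT.1
      · rw [← subset_expand_iff hP, expand_image hp hT.2]
        exact hT.2
    · intro R' _
      exact image_expand hP R'
    · intro T hT
      exact expand_image hp (mem_filter.1 hT).2
    · intro _ _
      rfl
  exact (congrFun this R).symm

/-- The weight of a dividend depends only on the number of players outside the coalition being
indexed. Those lie outside `P`, where the projection is injective, so contraction keeps both weight
and dividend. -/
theorem shapleyIndex_quotientGame (hp : p ∉ (Pᶜ).map (Function.Embedding.subtype (· ∈ N)))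
    (hP : P.Nonempty) {w : Game N} (hw : ∀ S, ¬ P ⊆ S → w.1 S = 0) (S : Finset N) :
    shapleyIndex (quotientGame w P p)
        ⟨insert (proxy P p) (S.image (proj P p)), insert_nonempty _ _⟩ =
      shapleyIndex w ⟨P ∪ S, hP.mono subset_union_left⟩ := by
  rw [shapleyIndex_eq_sum_dividend, shapleyIndex_eq_sum_dividend]
  have hQ : expand P p (insert (proxy P p) (S.image (proj P p))) = P ∪ S := by
    have : insert (proxy P p) (S.image (proj P p)) = (P ∪ S).image (proj P p) := by
      rw [image_union, insert_eq]
      congr 1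
      ext a
      rw [mem_singleton, mem_image]
      constructor
      · rintro rfl
        obtain ⟨i, hi⟩ := hP
        exact ⟨i, hi, proj_of_mem hi⟩
      · rintro ⟨i, hi, rfl⟩
        exact proj_of_mem hi
    rw [this, expand_image hp subset_union_left]
  have hsub : ∀ R : Finset (quotientPlayers P p),
      insert (proxy P p) (S.image (proj P p)) ⊆ R ↔ P ∪ S ⊆ expand P p R := by
    intro R
    rw [← hQ, expand_subset_iff hP]
  simp only [hsub]
  refine sum_bij' (fun R _ => expand P p R) (fun T _ => T.image (proj P p)) ?_ ?_ ?_ ?_ ?_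
  · intro R hR
    simpa using hR
  · intro T hT
    simp only [mem_filter, mem_univ, true_and] at hT ⊢
    rwa [expand_image hp (subset_union_left.trans hT)]
  · intro R _
    exact image_expand hP R
  · intro T hT
    exact expand_image hp (subset_union_left.trans (mem_filter.1 hT).2)
  · intro R hR
    have hPR : P ∪ S ⊆ expand P p R := (mem_filter.1 hR).2
    rw [dividend_quotientGame hp hP hw,
      if_pos ((subset_expand_iff hP).1 (subset_union_left.trans hPR))]
    congr 3
    have h1 : R \ insert (proxy P p) (S.image (proj P p)) =
        (expand P p R \ (P ∪ S)).image (proj P p) := by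
      rw [← image_expand hP (R \ _)]
      congr 1
      rw [← hQ]
      ext i
      simp only [mem_expand, mem_sdiff]
    rw [h1, card_image_of_injOn]
    intro i hi j hj h
    have hiP : i ∉ P := fun h => (mem_sdiff.1 hi).2 (mem_union_left _ h)
    have hjP : j ∉ P := fun h => (mem_sdiff.1 hj).2 (mem_union_left _ h)
    exact proj_injOn hiP hjP h

/-- Connected coalitions have connected images in the quotient graph. -/
theorem connIn_quotientGraph {Γ : SimpleGraph N} {R : Finset (quotientPlayers P p)} {i j : N}
    (h : ConnIn Γ (expand P p R) i j) :
    ConnIn (quotientGraph Γ P p) R (proj P p i) (proj P p j) := by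
  have hi := mem_expand.1 h.left_mem
  replace h := (connIn_iff.1 h).2.2
  induction h with
  | refl => exact .refl hi
  | @tail b c _ hbc ih =>
    by_cases e : proj P p b = proj P p c
    · rwa [← e]
    · exact ih.trans (.of_adj (mem_expand.1 hbc.1) (mem_expand.1 hbc.2.1)
        ⟨e, b, c, hbc.2.2, rfl, rfl⟩)

/-- Coalitions without the proxy are worth zero. For the others only the component `K` of the proxy
counts; its expansion is a union of components of the expanded coalition, and the rest misses `P`.
-/
theorem restrictedGame_quotientGame {Γ : SimpleGraph N} {v : Game N}
    (hQ : IsVetoGraphPartnership v Γ P) :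
    restrictedGame (quotientGame (restrictedGame v Γ) P p) (quotientGraph Γ P p) =
      quotientGame (restrictedGame v Γ) P p := by
  have hP := hQ.1
  have hw : ∀ S, ¬ P ⊆ S → (restrictedGame v Γ).1 S = 0 := fun S hS =>
    restrictedGame_eq_zero_of_isVetoGraphPartnership hQ hS
  have hzero : ∀ R : Finset (quotientPlayers P p), proxy P p ∉ R →
      (quotientGame (restrictedGame v Γ) P p).1 R = 0 := fun R hR =>
    hw _ fun h => hR ((subset_expand_iff hP).1 h)
  refine Subtype.ext (funext fun R => ?_)
  by_cases hR : proxy P p ∈ R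
  swap
  · rw [hzero R hR]
    exact restrictedGame_eq_zero fun C hC => hzero C fun h => hR (hC h)
  rw [restrictedGame_componentOf _ (i := proxy P p)]
  set K := componentOf (quotientGraph Γ P p) R (proxy P p) with hK
  have hpK : proxy P p ∈ K := mem_componentOf.2 (.refl hR)
  have h1 : (restrictedGame (quotientGame (restrictedGame v Γ) P p) (quotientGraph Γ P p)).1
      (R \ K) = 0 := restrictedGame_eq_zero fun C hC =>
    hzero C fun h => (mem_sdiff.1 (hC h)).2 hpK
  rw [h1, add_zero, quotientGame_apply, quotientGame_apply]
  have h2 := restrictedGame_split (Γ := Γ) v (A := expand P p K) (S := expand P p R)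
    (expand_mono componentOf_subset) (fun a ha b hb hab => by
      rw [mem_expand] at ha ⊢
      have := connIn_quotientGraph (.of_adj (mem_expand.2 (componentOf_subset ha)) hb hab)
      exact mem_componentOf.2 ((mem_componentOf.1 ha).trans this))
  rw [h2, hw (_ \ _), add_zero]
  intro h
  obtain ⟨i, hi⟩ := hP
  refine (mem_sdiff.1 (h hi)).2 ?_
  rw [mem_expand, proj_of_mem hi]
  exact hpK

end Quotients

theorem myersonIndex_strongReducedVetoPartnershipConsistency
    {ρ : (N : Finset ℕ+) → Finset N → ℕ+} (hρ : IsProxyNaming ρ) :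
    StrongReducedVetoPartnershipConsistency ρ myersonIndex := by
  intro N v Γ P hP S _
  rw [myersonIndex, myersonIndex, restrictedGame_quotientGame hP,
    shapleyIndex_quotientGame (hρ N P hP.1) hP.1 fun T hT =>
      restrictedGame_eq_zero_of_isVetoGraphPartnership hP hT]

/-! ### Moving coalitions along edges -/

section Moving

variable {V : Type*} [DecidableEq V] {Γ : SimpleGraph V} {D : Finset V → ℝ}

/-- A function of coalitions that does not change when a member moves to an unoccupied neighbour
does not change when a member moves to an unoccupied node of its component. -/
theorem insert_eq_insert_of_connIn
    (h : ∀ i j, Γ.Adj i j → ∀ S, i ∉ S → j ∉ S → D (insert i S) = D (insert j S))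
    {U : Finset V} {i j : V} (hij : ConnIn Γ U i j) :
    ∀ S, i ∉ S → j ∉ S → D (insert i S) = D (insert j S) := by
  replace hij := (connIn_iff.1 hij).2.2
  induction hij with
  | refl => exact fun _ _ _ => rfl
  | @tail b c _ hbc ih =>
    intro S hi hc
    have hadj := hbc.2.2
    by_cases hb : b ∈ S
    · by_cases hic : i = c
      · rw [hic]
      -- The node `b` before `c` is occupied: its occupant moves on to `c`, and then the member at
      -- `i` moves to `b`.
      · obtain ⟨S', hb', rfl⟩ : ∃ S', b ∉ S' ∧ insert b S' = S :=
          ⟨S.erase b, notMem_erase b S, insert_erase hb⟩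
        have hib : i ≠ b := fun e => hi (e ▸ hb)
        have hiS : i ∉ S' := fun h => hi (mem_insert_of_mem h)
        have hcS : c ∉ S' := fun h => hc (mem_insert_of_mem h)
        have h1 := h b c hadj (insert i S') (by simp [hib.symm, hb']) (by simp [Ne.symm hic, hcS])
        have h2 := ih (insert c S') (by simp [hic, hiS]) (by simp [hadj.ne, hb'])
        rw [insert_comm i b, h1, insert_comm c i, h2, insert_comm b c]
    · rw [ih S hi hb, h b c hadj S hb hc]

/-- The member moved to `t` is chosen different from `u`, which is possible as `S` has two members.
A second application can thus bring in another node without losing the first. -/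
theorem exists_eq_and_mem
    (h : ∀ i j, Γ.Adj i j → ∀ S, i ∉ S → j ∉ S → D (insert i S) = D (insert j S))
    {C S : Finset V} (hC : ∀ i ∈ C, ∀ j ∈ C, ConnIn Γ C i j) (hSC : S ⊆ C) (hS : 1 < S.card)
    {t : V} (ht : t ∈ C) (u : V) :
    ∃ S' ⊆ C, t ∈ S' ∧ S'.card = S.card ∧ D S' = D S ∧ (u ∈ S → u ∈ S') := by
  by_cases htS : t ∈ S
  · exact ⟨S, hSC, htS, rfl, rfl, id⟩
  · obtain ⟨x, hx, hxu⟩ := exists_mem_ne hS u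
    have htx : t ∉ S.erase x := fun h => htS (mem_of_mem_erase h)
    refine ⟨insert t (S.erase x), insert_subset ht ((erase_subset x S).trans hSC),
      mem_insert_self _ _, ?_, ?_, fun hu => mem_insert_of_mem (mem_erase.2 ⟨hxu.symm, hu⟩)⟩
    · rw [card_insert_of_notMem htx, card_erase_add_one hx]
    · rw [insert_eq_insert_of_connIn h (hC t ht x (hSC hx)) _ htx (notMem_erase x S),
        insert_erase hx]

theorem exists_eq_and_mem_mem
    (h : ∀ i j, Γ.Adj i j → ∀ S, i ∉ S → j ∉ S → D (insert i S) = D (insert j S))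
    {C S : Finset V} (hC : ∀ i ∈ C, ∀ j ∈ C, ConnIn Γ C i j) (hSC : S ⊆ C) (hS : 1 < S.card)
    {t u : V} (ht : t ∈ C) (hu : u ∈ C) :
    ∃ S', t ∈ S' ∧ u ∈ S' ∧ S'.card = S.card ∧ D S' = D S := by
  obtain ⟨S₁, h1, ht1, hc1, hD1, -⟩ := exists_eq_and_mem h hC hSC hS ht u
  obtain ⟨S₂, -, hu2, hc2, hD2, ht2⟩ := exists_eq_and_mem h hC h1 (hc1 ▸ hS) hu t
  exact ⟨S₂, ht2 ht1, hu2, hc2.trans hc1, hD2.trans hD1⟩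

end Moving

/-! ### Null players and veto partnerships in unanimity games -/

section Unanimity

variable {V : Type*} [DecidableEq V]

theorem isNullPlayer_unanimity {T : Finset V} {i : V} (hi : i ∉ T) :
    IsNullPlayer (unanimity T) i := by
  intro S _
  simp only [unanimity_apply, subset_insert_iff_of_notMem hi]

theorem isVetoPartnership_unanimity {T : Finset V} (hT : T.Nonempty) :
    IsVetoPartnership (unanimity T) T := by
  refine ⟨hT, fun A S hA hS => ?_⟩
  have h1 : ¬ T ⊆ A ∪ S := fun h => hS.2 (hA.symm.left_le_of_le_sup_left h)
  have h2 : ¬ T ⊆ A := fun h => h1 (h.trans subset_union_left)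
  simp [unanimity_apply, h1, h2]

/-- Only `t` is not null, so any two distinct players include a null one. -/
theorem isGraphNull_unanimity_singleton [Fintype V] {Γ : SimpleGraph V} {t i : V} (hi : i ≠ t) :
    IsGraphNull (unanimity {t}) Γ i := by
  refine ⟨isNullPlayer_unanimity (by simpa using hi), fun j k _ _ hjk _ => ?_⟩
  by_cases hj : j = t
  · exact .inr (isNullPlayer_unanimity (by simpa using fun h => hjk (hj.trans h.symm)))
  · exact .inl (isNullPlayer_unanimity (by simpa using hj))

end Unanimity

/-! ### Uniqueness -/

/-- `I` is a graph interaction index with the five properties. -/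
structure SatisfiesAxioms (ρ : (N : Finset ℕ+) → Finset N → ℕ+) (I : Index) : Prop where
  isIndex : IsGraphInteractionIndex I
  componentEfficiency : ComponentEfficiency I
  fairness : Fairness I
  graphNull : GraphNull I
  linearity : Linearity I
  consistency : StrongReducedVetoPartnershipConsistency ρ I

theorem Linearity.zero {I : Index} (hI : Linearity I) {N : Finset ℕ+} (Γ : SimpleGraph N)
    (S : Coalition N) : I N 0 Γ S = 0 := by
  have := hI N 0 0 0 0 Γ S
  simpa using this

/-- A linear index is determined by its values on unanimity games. -/
theorem Linearity.eq_of_unanimity {I J : Index} (hI : Linearity I) (hJ : Linearity J)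
    {N : Finset ℕ+} (v : Game N) (Γ : SimpleGraph N) (S : Coalition N)
    (h : ∀ T : Finset N, T.Nonempty → I N (unanimity T) Γ S = J N (unanimity T) Γ S) :
    I N v Γ S = J N v Γ S := by
  have hsum : ∀ K : Index, Linearity K → ∀ A : Finset (Finset N),
      K N (∑ T ∈ A, dividend v.1 T • unanimity T) Γ S =
        ∑ T ∈ A, dividend v.1 T * K N (unanimity T) Γ S := by
    intro K hK A
    induction A using Finset.induction_on with
    | empty => simpa using hK.zero Γ S
    | insert T A hT ih =>
      rw [sum_insert hT, sum_insert hT, ← ih]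
      have := hK N (dividend v.1 T) 1 (unanimity T) (∑ T ∈ A, dividend v.1 T • unanimity T) Γ S
      rwa [one_smul, one_mul] at this
  rw [game_eq_sum_unanimity v, hsum I hI, hsum J hJ]
  refine sum_congr rfl fun T _ => ?_
  rcases T.eq_empty_or_nonempty with rfl | hT
  · rw [dividend_empty, zero_mul, zero_mul]
  · rw [h T hT]

/-- The index of a coalition in a component vanishes in the unanimity game of a coalition that is
not contained in this component. -/
theorem SatisfiesAxioms.eq_zero_of_not_subset {ρ : (N : Finset ℕ+) → Finset N → ℕ+} {I : Index}
    (hI : SatisfiesAxioms ρ I) {N : Finset ℕ+} {Γ : SimpleGraph N} {C T : Finset N}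
    (hC : C ∈ components Γ univ) (hT : ¬ T ⊆ C) {S : Coalition N} (hS : S.1 ⊆ C) :
    I N (unanimity T) Γ S = 0 := by
  set C' : Finset ℕ+ := C.map (Function.Embedding.subtype (· ∈ N)) with hC'
  have hCN : C' ⊆ N := by
    intro x hx
    obtain ⟨y, _, rfl⟩ := mem_map.1 hx
    exact y.2
  have hmem : ∀ x : N, x ∈ C ↔ x.1 ∈ C' := fun x => by
    rw [hC', mem_map]
    exact ⟨fun h => ⟨x, h, rfl⟩, fun ⟨y, hy, e⟩ => (Subtype.ext e : y = x) ▸ hy⟩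
  have huniv : (univ : Finset C').map (incl hCN) = C := by
    ext x
    rw [mem_map]
    constructor
    · rintro ⟨y, _, rfl⟩
      exact (hmem _).2 y.2
    · exact fun hx => ⟨⟨x.1, (hmem x).1 hx⟩, mem_univ _, rfl⟩
  obtain ⟨A, _, hA⟩ := subset_map_iff.1 (huniv.symm ▸ hS : S.1 ⊆ (univ : Finset C').map (incl hCN))
  have hAne : A.Nonempty := by
    have := S.2
    rwa [hA, map_nonempty] at this
  have hSA : S = ⟨A.map (incl hCN), hAne.map⟩ := Subtype.ext hA
  have hzero : restrictTo (unanimity T) (incl hCN) = 0 := by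
    refine Subtype.ext (funext fun R => ?_)
    change (if T.Nonempty ∧ T ⊆ R.map (incl hCN) then (1 : ℝ) else 0) = 0
    refine if_neg fun h => hT (h.2.trans ?_)
    rw [← huniv]
    exact map_subset_map.2 (subset_univ R)
  have := (hI.isIndex N (unanimity T) Γ).2 C' hCN (huniv.symm ▸ hC) ⟨A, hAne⟩
  rw [hSA, this, hzero, hI.linearity.zero]

theorem SatisfiesAxioms.unique {ρ : (N : Finset ℕ+) → Finset N → ℕ+} {I J : Index}
    (hI : SatisfiesAxioms ρ I) (hJ : SatisfiesAxioms ρ J) : I = J := by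
  suffices H : ∀ (s : ℕ) (N : Finset ℕ+) (Γ : SimpleGraph N) (v : Game N) (S : Coalition N),
      S.1.card = s → I N v Γ S = J N v Γ S by
    funext N v Γ S
    exact H _ N Γ v S rfl
  -- The size is the outer induction, over all player sets, because contraction lowers it but
  -- changes `N` and the graph. Removing an edge keeps `N` and `s`.
  intro s
  induction s using Nat.strong_induction_on with
  | _ s ihs =>
  intro N Γ
  induction Γ using WellFoundedLT.induction with
  | _ Γ ihΓ =>
  -- the difference of the two indices is invariant under moves along edges
  have hmove : ∀ v : Game N, ∃ D : Finset N → ℝ,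
      (∀ S : Coalition N, S.1.card = s → D S.1 = I N v Γ S - J N v Γ S) ∧
      ∀ i j, Γ.Adj i j → ∀ S, i ∉ S → j ∉ S → D (insert i S) = D (insert j S) := by
    intro v
    -- The default value zero for other sizes makes the invariance trivial there.
    refine ⟨fun S => if h : S.Nonempty ∧ S.card = s then I N v Γ ⟨S, h.1⟩ - J N v Γ ⟨S, h.1⟩
      else 0, fun S hS => dif_pos ⟨S.2, hS⟩, fun i j hij S hi hj => ?_⟩
    have hci := card_insert_of_notMem hi
    have hcj := card_insert_of_notMem hj
    by_cases hs : S.card + 1 = s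
    · have hlt : Γ.deleteEdges {s(i, j)} < Γ := by
        refine lt_of_le_of_ne (Γ.deleteEdges_le _) fun e => ?_
        rw [← e, SimpleGraph.deleteEdges_adj] at hij
        exact hij.2 rfl
      beta_reduce
      rw [dif_pos ⟨insert_nonempty i S, hci.trans hs⟩, dif_pos ⟨insert_nonempty j S, hcj.trans hs⟩]
      have h1 := hI.fairness N v Γ i j hij S hi hj
      have h2 := hJ.fairness N v Γ i j hij S hi hj
      have h3 := ihΓ _ hlt v ⟨insert i S, insert_nonempty i S⟩ (hci.trans hs)
      have h4 := ihΓ _ hlt v ⟨insert j S, insert_nonempty j S⟩ (hcj.trans hs)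
      linarith
    · beta_reduce
      rw [dif_neg fun h => hs (hci.symm.trans h.2), dif_neg fun h => hs (hcj.symm.trans h.2)]
  intro v S hS
  by_cases hex : ∃ C ∈ components Γ univ, S.1 ⊆ C
  swap
  · rw [(hI.isIndex N v Γ).1 S hex, (hJ.isIndex N v Γ).1 S hex]
  obtain ⟨C, hC, hSC⟩ := hex
  have hconn := component_connected hC
  by_cases hs : 1 < s
  · refine hI.linearity.eq_of_unanimity hJ.linearity v Γ S fun T hT => ?_
    by_cases hTC : T ⊆ C
    swap
    · rw [hI.eq_zero_of_not_subset hC hTC hSC, hJ.eq_zero_of_not_subset hC hTC hSC]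
    by_cases hT1 : 1 < T.card
    · obtain ⟨t, ht, u, hu, htu⟩ := one_lt_card.1 hT1
      obtain ⟨D, hD, hDm⟩ := hmove (unanimity T)
      obtain ⟨S', htS, huS, hcard, hDS⟩ :=
        exists_eq_and_mem_mem hDm hconn hSC (hS.symm ▸ hs) (hTC ht) (hTC hu)
      rw [hD S hS] at hDS
      have hQS : ({t, u} : Finset N) ⊆ S' := by
        rw [insert_subset_iff, singleton_subset_iff]
        exact ⟨htS, huS⟩
      -- A pair inside the veto partnership `T` is enough; `T` itself may be larger than `s`.
      have hQ : IsVetoGraphPartnership (unanimity T) Γ {t, u} := by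
        refine ⟨insert_nonempty _ _, T, isVetoPartnership_unanimity hT, ?_⟩
        rw [insert_subset_iff, singleton_subset_iff]
        exact ⟨mem_union_left _ ht, mem_union_left _ hu⟩
      have e : S' = {t, u} ∪ S' \ {t, u} := (union_sdiff_of_subset hQS).symm
      have h1 := hI.consistency N _ Γ _ hQ (S' \ {t, u}) sdiff_disjoint
      have h2 := hJ.consistency N _ Γ _ hQ (S' \ {t, u}) sdiff_disjoint
      -- Two members are replaced by one proxy; only this upper bound is needed for the induction.
      have hlt : (insert (proxy {t, u} (ρ N {t, u}))
          ((S' \ {t, u}).image (proj {t, u} (ρ N {t, u})))).card < s := by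
        have c1 := card_insert_le (proxy {t, u} (ρ N {t, u}))
          ((S' \ {t, u}).image (proj {t, u} (ρ N {t, u})))
        have c2 := card_image_le (s := S' \ {t, u}) (f := proj {t, u} (ρ N {t, u}))
        have c3 := card_sdiff_add_card_eq_card hQS
        rw [card_pair htu] at c3
        omega
      have h3 := ihs _ hlt _ (quotientGraph Γ {t, u} (ρ N {t, u}))
        (quotientGame (restrictedGame (unanimity T) Γ) {t, u} (ρ N {t, u}))
        ⟨_, insert_nonempty _ _⟩ rfl
      have h4 := hD ⟨{t, u} ∪ S' \ {t, u}, hQ.1.mono subset_union_left⟩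
        ((congrArg card e.symm).trans (hcard.trans hS))
      rw [h1, h2, h3, sub_self] at h4
      exact sub_eq_zero.1 (hDS.symm.trans ((congrArg D e).trans h4))
    · obtain ⟨t, rfl⟩ := card_eq_one.1 (le_antisymm (not_lt.1 hT1) hT.card_pos)
      obtain ⟨i, hi, hit⟩ := exists_mem_ne (hS.symm ▸ hs : 1 < S.1.card) t
      have hnull := isGraphNull_unanimity_singleton (Γ := Γ) hit
      have e : S = ⟨insert i (S.1.erase i), insert_nonempty _ _⟩ :=
        Subtype.ext (insert_erase hi).symm
      rw [e, hI.graphNull N _ Γ i hnull _ (notMem_erase i S.1),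
        hJ.graphNull N _ Γ i hnull _ (notMem_erase i S.1)]
  · have hs1 : S.1.card = 1 := by
      have := S.2.card_pos
      omega
    obtain rfl : s = 1 := hS.symm.trans hs1
    obtain ⟨i, hi⟩ := card_eq_one.1 hs1
    obtain ⟨D, hD, hDm⟩ := hmove v
    have hiC : i ∈ C := hSC (hi ▸ mem_singleton_self i)
    -- A singleton is `insert j ∅`, so its only member moves freely in `C`.
    have hconst : ∀ j ∈ C, D {j} = D {i} := fun j hj =>
      insert_eq_insert_of_connIn hDm (hconn j hj i hiC) ∅ (notMem_empty _) (notMem_empty _)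
    have hsum : ∑ j ∈ C, D {j} = 0 := by
      rw [sum_congr rfl fun j _ => hD ⟨{j}, singleton_nonempty j⟩ (card_singleton j),
        sum_sub_distrib, hI.componentEfficiency N v Γ C hC, hJ.componentEfficiency N v Γ C hC,
        sub_self]
    rw [sum_congr rfl hconst, sum_const, nsmul_eq_mul] at hsum
    have hC0 : (C.card : ℝ) ≠ 0 := by exact_mod_cast (component_nonempty hC).card_pos.ne'
    have h0 := (mul_eq_zero.1 hsum).resolve_left hC0
    rw [← hi, hD S hS] at h0
    exact sub_eq_zero.1 h0

theorem satisfiesAxioms_myersonIndex {ρ : (N : Finset ℕ+) → Finset N → ℕ+}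
    (hρ : IsProxyNaming ρ) : SatisfiesAxioms ρ myersonIndex :=
  ⟨myersonIndex_isGraphInteractionIndex, myersonIndex_componentEfficiency, myersonIndex_fairness,
    myersonIndex_graphNull, myersonIndex_linearity,
    myersonIndex_strongReducedVetoPartnershipConsistency hρ⟩

end Myerson

/-- For every naming rule for proxies, the Myerson interaction index is a graph interaction index
with the five properties, and it is the only one. -/
theorem mainTheorem1 (ρ : (N : Finset ℕ+) → Finset N → ℕ+) (hρ : Myerson.IsProxyNaming ρ)
    (I : Myerson.Index) :
    (Myerson.IsGraphInteractionIndex I ∧ Myerson.ComponentEfficiency I ∧ Myerson.Fairness I ∧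
      Myerson.GraphNull I ∧ Myerson.Linearity I ∧
      Myerson.StrongReducedVetoPartnershipConsistency ρ I) ↔
      I = Myerson.myersonIndex := by
  have hM := Myerson.satisfiesAxioms_myersonIndex hρ
  constructor
  · rintro ⟨h1, h2, h3, h4, h5, h6⟩
    exact Myerson.SatisfiesAxioms.unique ⟨h1, h2, h3, h4, h5, h6⟩ hM
  · rintro rfl
    exact ⟨hM.1, hM.2, hM.3, hM.4, hM.5, hM.6⟩
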